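/- A partial finite automaton (PFA) consists of a finite set $Q$ of states, an alphabet $\Sigma$ and a transition function $Q \times \Sigma \to Q \cup \{\bot\}$, $(q,a) \mapsto qa$. For $S \subseteq Q$ and $a \in \Sigma$ put $Sa = \{sa : s \in S\}$ if $sa \neq \bot$ for all $s \in S$, and $Sa = \varnothing$ otherwise; for a word $w = a_1 a_2 \cdots a_l$ put $Sw = (\cdots((Sa_1)a_2)\cdots)a_l$. The PFA (carefully) synchronizes $S$ if $|Sw| = 1$ for some word $w$, and the synchronization length of $S$ is then the minimum length of such a word. For $3 \le n \le 5$ and $2 \le k \le n$, let $t(n,k)$ be given by $$ \begin{array}{c|ccc} k & n = 3 & n = 4 & n = 5 \\ \hline 2 & 3 & 6 & 10 \\ 3 & 4 & 10 & 20 \\ 4 & & 10 & 22 \\ 5 & & & 21 \end{array} $$ **Theorem.** (1) Let $S$ be a subset of the states of a PFA with $n \le 5$ states, and suppose that the PFA synchronizes $S$, but does not synchronize all nonempty subsets of states of size less than $|S|$. Then the synchronization length of $S$ is less than $t(n,|S|)$. (As singletons always synchronize, the hypotheses imply that $|S| \ge 3$ and $n \ge 3$, so that $t(n,|S|)$ is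 defined.) (2) In particular, for $3 \le n \le 5$ and $2 \le k \le n$, the maximum synchronization length of a subset of size $k$ that is synchronized by a PFA with $n$ states, over all PFAs with $n$ states and all such subsets, equals $t(n,k)$: every such synchronization length is at most $t(n,k)$, for any alphabet, and $t(n,k)$ is attained, by a PFA with a finite alphabet. -/

import Mathlib

universe u v

/-- A partial finite automaton (PFA) with state set `Q` and alphabet `A`: the transition function
sends a state and a letter to a state, or to `none` (written `⊥` in the literature), in which case
the letter is undefined at that state. -/
structure PartialAutomaton (Q : Type*) (A : Type*) where
  /-- The partial transition function. -/
  step : Q → A → Option Q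

namespace PartialAutomaton

variable {Q A : Type*} [DecidableEq Q]

/-- The action of a letter on a set of states: `S a = {s a | s ∈ S}` if `a` is defined at all
states of `S`, and `S a = ∅` otherwise. -/
def stepSet (M : PartialAutomaton Q A) (S : Finset Q) (a : A) : Finset Q :=
  if ∀ s ∈ S, M.step s a ≠ none then S.biUnion (fun s => (M.step s a).toFinset) else ∅

/-- The action of a word on a set of states, letter by letter from left to right. -/
def runSet (M : PartialAutomaton Q A) (S : Finset Q) : List A → Finset Q
  | [] => S
  | a :: w => M.runSet (M.stepSet S a) w

/-- `M` carefully synchronizes the set of states `S` in `l` steps. -/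
def SynchronizesIn (M : PartialAutomaton Q A) (S : Finset Q) (l : ℕ) : Prop :=
  ∃ w : List A, w.length = l ∧ (M.runSet S w).card = 1

/-- `M` carefully synchronizes the set of states `S`. -/
def Synchronizes (M : PartialAutomaton Q A) (S : Finset Q) : Prop :=
  ∃ l : ℕ, M.SynchronizesIn S l

/-- The length of a shortest word that carefully synchronizes `S`. It is only meaningful if
`M.Synchronizes S`. -/
noncomputable def syncLength (M : PartialAutomaton Q A) (S : Finset Q) : ℕ :=
  sInf {l : ℕ | M.SynchronizesIn S l}

end PartialAutomaton

/-- The table of subset synchronization lengths of PFAs: `pfaTable n k` is the entry for `n` states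
and subsets of size `k`. The entries are those with `3 ≤ n ≤ 5` and `2 ≤ k ≤ n`; the value `0`
elsewhere is a dummy. -/
def pfaTable : ℕ → ℕ → ℕ
  | 3, 2 => 3
  | 3, 3 => 4
  | 4, 2 => 6
  | 4, 3 => 10
  | 4, 4 => 10
  | 5, 2 => 10
  | 5, 3 => 20
  | 5, 4 => 22
  | 5, 5 => 21
  | _, _ => 0

/-! Call the synchronization length of a set its level, and sets of two, three and four states
pairs, triples and quads. The first letter of a shortest word takes a set on level r + 1 to a set on
level exactly r that is no larger. So below a set on level r there is a set on each level, these
sets are distinct, and on positive levels none is a singleton. Counting them (`sub_le_card`,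
`level_le_sum`) bounds r by the sum of the binomials C(n,i), 2 ≤ i ≤ k. For k ≤ 3 this is the table
entry, and it becomes strict when some smaller set never synchronizes.

The remaining upper bounds use that a letter defined on X acts on all subsets of X. If it merges p
and q, then a subset containing both loses a state, so it lies at most one level above the bound for
smaller sets (`merged_within`). In particular, two triples are on levels at most C(n,2) + 1
(`exists_low_triples`) and cannot serve on the levels above. This settles quads for n = 4, and quads
for n = 5 when a smaller set does not synchronize. For all five states, a refined count is needed
(`level_univ_le`).

The hard case is a quad for n = 5, with bound 22 (`level_le_of_quad`). A quad on level 23 lies on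
top of a chain of quads on levels L + 1, ..., 23 above a triple on level L, with L = 18 or L = 19.
After renumbering, the quad on level L + 1 + i omits state i. The counts are then almost tight: the
ten pairs fill levels 1 to c with c = 9 or c = 10, and at most one triple is spare. On the other
hand, the bijection between consecutive quads pulls every synchronizable pair or triple inside its
target back with a delay of at most one level, and the letter from the lowest quad onto the triple
imposes similar conditions. An exhaustive search over the assignments of levels finds none that
meets all conditions. `search_ne_true` shows that such a chain would make the search fail, whereas
the four searches that are needed evaluate to `true`.

The entries are attained by explicit automata: a word bounds the length from above, and a potential
on sets bounds it from below. -/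

/-- `R r X` says that the set `X` of states can be synchronized in at most `r` steps; all that is
used about it is recorded here. -/
structure Layering {Q : Type*} [DecidableEq Q] (R : ℕ → Finset Q → Prop) : Prop where
  zero_iff : ∀ X, R 0 X ↔ X.card = 1
  succ : ∀ {r X}, R r X → R (r + 1) X
  step : ∀ {r X}, R (r + 1) X → ¬ R r X →
    ∃ f : Q → Q, R r (X.image f) ∧ ∀ Y ⊆ X, ∀ j, R j (Y.image f) → R (j + 1) Y

/-- The set `X` is on level `r` of `R`. -/
def AtLevel {Q : Type*} (R : ℕ → Finset Q → Prop) (r : ℕ) (X : Finset Q) : Prop :=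
  R r X ∧ ∀ j < r, ¬ R j X

/-! ### Synchronization within r steps is a layering -/

namespace PartialAutomaton

variable {Q : Type*} {A : Type*} [DecidableEq Q] (M : PartialAutomaton Q A)

/-- `M` synchronizes `X` in at most `r` steps. -/
def SyncWithin (r : ℕ) (X : Finset Q) : Prop := ∃ l ≤ r, M.SynchronizesIn X l

theorem stepSet_empty (a : A) : M.stepSet ∅ a = ∅ := by simp [stepSet]

theorem runSet_empty (w : List A) : M.runSet ∅ w = ∅ := by
  induction w with
  | nil => rfl
  | cons a w ih => simp [runSet, stepSet_empty, ih]

/-- A nonempty result means that the letter is defined on all of `X`, so the default value of `getD`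
plays no role there. One total map thus describes the letter on all subsets of `X` at once. -/
theorem stepSet_eq_image {X Y : Finset Q} {a : A} (hX : (M.stepSet X a).Nonempty) (hY : Y ⊆ X) :
    M.stepSet Y a = Y.image fun q => (M.step q a).getD q := by
  have h : ∀ s ∈ X, M.step s a ≠ none := by
    by_contra hn
    rw [stepSet, if_neg hn] at hX
    exact Finset.not_nonempty_empty hX
  rw [stepSet, if_pos fun s hs => h s (hY hs)]
  ext q
  simp only [Finset.mem_biUnion, Option.mem_toFinset, Finset.mem_image]
  refine exists_congr fun s => and_congr_right fun hs => ?_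
  obtain ⟨t, ht⟩ := Option.ne_none_iff_exists'.mp (h s (hY hs))
  simp [ht]

theorem layering_syncWithin : Layering M.SyncWithin where
  zero_iff X := by
    constructor
    · rintro ⟨l, hl, w, hw, hc⟩
      obtain rfl : l = 0 := by omega
      obtain rfl := List.length_eq_zero_iff.mp hw
      exact hc
    · exact fun h => ⟨0, le_rfl, [], rfl, h⟩
  succ := fun ⟨l, hl, h⟩ => ⟨l, by omega, h⟩
  step := by
    rintro r X ⟨l, hl, w, hw, hc⟩ hn
    cases w with
    | nil =>
      exact (hn ⟨0, by omega, [], rfl, hc⟩).elim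
    | cons a w =>
      have hne : (M.stepSet X a).Nonempty := by
        rw [Finset.nonempty_iff_ne_empty]
        intro h0
        rw [runSet, h0, runSet_empty] at hc
        simp at hc
      refine ⟨fun q => (M.step q a).getD q, ?_, ?_⟩
      · rw [← M.stepSet_eq_image hne subset_rfl]
        refine ⟨w.length, ?_, w, rfl, hc⟩
        simp at hw
        omega
      · rintro Y hY j ⟨i, hi, v, hv, hvc⟩
        rw [← M.stepSet_eq_image hne hY] at hvc
        exact ⟨i + 1, by omega, a :: v, by simp [hv], hvc⟩

theorem atLevel_syncLength {S : Finset Q} (h : M.Synchronizes S) :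
    AtLevel M.SyncWithin (M.syncLength S) S := by
  refine ⟨⟨_, le_rfl, Nat.sInf_mem h⟩, ?_⟩
  rintro j hj ⟨l, hl, hs⟩
  have : M.syncLength S ≤ l := Nat.sInf_le hs
  omega

end PartialAutomaton

/-! ### Descending through the levels -/

namespace Layering

variable {Q : Type*} [DecidableEq Q] {R : ℕ → Finset Q → Prop} (hR : Layering R)
include hR

theorem mono {i j : ℕ} (hij : i ≤ j) {X : Finset Q} (h : R i X) : R j X := by
  induction hij with
  | refl => exact h
  | step _ ih => exact hR.succ ih

theorem not_empty (r : ℕ) : ¬ R r ∅ := by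
  induction r with
  | zero => simp [hR.zero_iff]
  | succ r ih =>
    intro h
    obtain ⟨f, hf, _⟩ := hR.step h ih
    exact ih (by simpa using hf)

theorem nonempty {r : ℕ} {X : Finset Q} (h : R r X) : X.Nonempty := by
  rw [Finset.nonempty_iff_ne_empty]
  rintro rfl
  exact hR.not_empty r h

/-- A letter that is defined on a set is defined on its subsets, and it preserves inclusions. -/
theorem subset {r : ℕ} {X Y : Finset Q} (h : R r X) (hY : Y ⊆ X) (hne : Y.Nonempty) : R r Y := by
  induction r generalizing X Y with
  | zero =>
    rw [hR.zero_iff] at h ⊢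
    have := Finset.card_le_card hY
    have := hne.card_pos
    omega
  | succ r ih =>
    by_cases hr : R r X
    · exact hR.succ (ih hr hY hne)
    · obtain ⟨f, hf, hm⟩ := hR.step h hr
      exact hm Y hY r (ih hf (Finset.image_subset_image hY) (hne.image f))

theorem of_card_eq_one {X : Finset Q} (h : X.card = 1) (r : ℕ) : R r X :=
  hR.mono (Nat.zero_le r) ((hR.zero_iff X).mpr h)

theorem exists_atLevel {r : ℕ} {X : Finset Q} (h : R r X) : ∃ j ≤ r, AtLevel R j X := by
  classical
  have hex : ∃ j, R j X := ⟨r, h⟩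
  exact ⟨Nat.find hex, Nat.find_min' hex h, Nat.find_spec hex, fun j hj => Nat.find_min hex hj⟩

theorem atLevel_of_not {r : ℕ} {X : Finset Q} (h : R (r + 1) X) (hn : ¬ R r X) :
    AtLevel R (r + 1) X :=
  ⟨h, fun j hj hj' => hn (hR.mono (by omega) hj')⟩

theorem two_le_card {r : ℕ} {X : Finset Q} (h : AtLevel R r X) (hr : 1 ≤ r) : 2 ≤ X.card := by
  have h0 := (hR.nonempty h.1).card_pos
  have h1 : X.card ≠ 1 := fun hc => h.2 0 hr ((hR.zero_iff X).mpr hc)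
  omega

theorem atLevel_le {r j : ℕ} {X : Finset Q} (h : AtLevel R r X) (hj : R j X) : r ≤ j := by
  by_contra hlt
  exact h.2 j (by omega) hj

theorem atLevel_unique {r j : ℕ} {X : Finset Q} (h : AtLevel R r X) (hj : AtLevel R j X) : r = j :=
  le_antisymm (hR.atLevel_le h hj.1) (hR.atLevel_le hj h.1)

/-- The image is on level exactly `r`: a lower level for the image would give a lower one for `X`.
-/
theorem exists_step {r : ℕ} {X : Finset Q} (h : AtLevel R (r + 1) X) :
    ∃ f : Q → Q, AtLevel R r (X.image f) ∧ ∀ Y ⊆ X, ∀ j, R j (Y.image f) → R (j + 1) Y := by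
  obtain ⟨f, hf, hm⟩ := hR.step h.1 (h.2 r (by omega))
  exact ⟨f, ⟨hf, fun j hj hj' => h.2 (j + 1) (by omega) (hm X subset_rfl j hj')⟩, hm⟩

theorem exists_atLevel_of_le {r j : ℕ} {X : Finset Q} (h : AtLevel R r X) (hj : j ≤ r) :
    ∃ Y, AtLevel R j Y ∧ Y.card ≤ X.card := by
  induction r generalizing X with
  | zero => exact ⟨X, by rwa [Nat.le_zero.mp hj], le_rfl⟩
  | succ r ih =>
    rcases Nat.lt_or_ge r j with hlt | hge
    · obtain rfl : j = r + 1 := by omega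
      exact ⟨X, h, le_rfl⟩
    · obtain ⟨f, hf, _⟩ := hR.exists_step h
      obtain ⟨Y, hY, hc⟩ := ih hf hge
      exact ⟨Y, hY, hc.trans Finset.card_image_le⟩

/-- The levels in `(i, r]` below a set are hit by distinct sets. -/
theorem sub_le_card {i r : ℕ} {X : Finset Q} (h : AtLevel R r X) (F : Finset (Finset Q))
    (hF : ∀ Y j, i < j → j ≤ r → AtLevel R j Y → Y.card ≤ X.card → Y ∈ F) : r - i ≤ F.card := by
  choose! g hg hc using fun j (hj : j ≤ r) => hR.exists_atLevel_of_le h hj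
  have : (Finset.Ioc i r).card ≤ F.card := by
    refine Finset.card_le_card_of_injOn g ?_ ?_
    · intro j hj
      simp only [Finset.coe_Ioc, Set.mem_Ioc] at hj
      exact hF _ j hj.1 hj.2 (hg j hj.2) (hc j hj.2)
    · intro j hj k hk hjk
      simp only [Finset.coe_Ioc, Set.mem_Ioc] at hj hk
      exact hR.atLevel_unique (hg j hj.2) (hjk ▸ hg k hk.2)
  simpa using this

end Layering

theorem Finset.exists_subset_image_eq {α β : Type*} [DecidableEq α] [DecidableEq β] {X : Finset α}
    {f : α → β} (hf : (X.image f).card = X.card) {Z : Finset β} (hZ : Z ⊆ X.image f) :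
    ∃ Y ⊆ X, Y.image f = Z ∧ Y.card = Z.card := by
  obtain ⟨Y, hY, rfl⟩ := Finset.subset_image_iff.mp hZ
  exact ⟨Y, hY, rfl, (Finset.card_image_of_injOn ((Finset.card_image_iff.mp hf).mono hY)).symm⟩

theorem Finset.card_image_lt_of_eq {α β : Type*} [DecidableEq α] [DecidableEq β] {X : Finset α}
    {f : α → β} {p q : α} (hp : p ∈ X) (hq : q ∈ X) (hpq : p ≠ q) (h : f p = f q) :
    (X.image f).card < X.card := by
  refine lt_of_le_of_ne Finset.card_image_le fun hc => hpq ?_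
  exact Finset.card_image_iff.mp hc hp hq h

/-! ### Counting bounds for an arbitrary number of states, and quads for n = 4 -/

namespace Layering

variable {Q : Type*} [DecidableEq Q] {R : ℕ → Finset Q → Prop} (hR : Layering R)
include hR

/-- Allows renaming the states, in particular to `Fin 5`, where finite statements can be decided. -/
theorem map_equiv {P : Type*} [DecidableEq P] (e : P ≃ Q) :
    Layering fun r (X : Finset P) => R r (X.map e.toEmbedding) where
  zero_iff X := by simp [hR.zero_iff]
  succ h := hR.succ h
  step {r X} h hn := by
    obtain ⟨f, hf, hm⟩ := hR.step h hn
    have key : ∀ Y : Finset P, (Y.image fun x => e.symm (f (e x))).map e.toEmbedding =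
        (Y.map e.toEmbedding).image f := by
      intro Y
      ext q
      simp only [Finset.mem_map_equiv, Finset.mem_image]
      constructor
      · rintro ⟨a, ha, h⟩
        exact ⟨e a, by simpa using ha, by simpa [Equiv.symm_apply_eq] using h⟩
      · rintro ⟨a, ha, h⟩
        exact ⟨e.symm a, ha, by simpa [Equiv.symm_apply_eq] using h⟩
    refine ⟨fun x => e.symm (f (e x)), by rwa [key], fun Y hY j hj => ?_⟩
    rw [key] at hj
    exact hm _ (Finset.map_subset_map.mpr hY) j hj

variable [Fintype Q]

theorem level_le_sum {r : ℕ} {X : Finset Q} (h : AtLevel R r X) :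
    r ≤ ∑ i ∈ Finset.Icc 2 X.card, (Fintype.card Q).choose i := by
  have := hR.sub_le_card (i := 0) h ((Finset.Icc 2 X.card).biUnion (Finset.powersetCard · .univ))
    (fun Y j hj _ hY hc => by simpa using ⟨hR.two_le_card hY hj, hc⟩)
  refine (Nat.sub_zero r ▸ this).trans (Finset.card_biUnion_le.trans (le_of_eq ?_))
  simp [Finset.card_powersetCard]

theorem level_lt_sum {r : ℕ} {X T : Finset Q} (h : AtLevel R r X) (hT : ∀ j, ¬ R j T)
    (hT2 : 2 ≤ T.card) (hTX : T.card ≤ X.card) :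
    r < ∑ i ∈ Finset.Icc 2 X.card, (Fintype.card Q).choose i := by
  have hmem : T ∈ (Finset.Icc 2 X.card).biUnion
      (Finset.powersetCard · (Finset.univ : Finset Q)) := by simpa using ⟨hT2, hTX⟩
  have := hR.sub_le_card (i := 0) h
    (((Finset.Icc 2 X.card).biUnion (Finset.powersetCard · .univ)).erase T)
    (fun Y j hj _ hY hc => by
      refine Finset.mem_erase.mpr ⟨fun hYT => hT j (hYT ▸ hY.1), ?_⟩
      simpa using ⟨hR.two_le_card hY hj, hc⟩)
  rw [Nat.sub_zero, Finset.card_erase_of_mem hmem] at this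
  have hpos := Finset.card_pos.mpr ⟨T, hmem⟩
  have hle : ((Finset.Icc 2 X.card).biUnion
      (Finset.powersetCard · (Finset.univ : Finset Q))).card ≤
      ∑ i ∈ Finset.Icc 2 X.card, (Fintype.card Q).choose i := by
    refine Finset.card_biUnion_le.trans (le_of_eq ?_)
    simp [Finset.card_powersetCard]
  omega

theorem pair_within {r : ℕ} {X : Finset Q} (h : R r X) (hc : X.card ≤ 2) :
    R ((Fintype.card Q).choose 2) X := by
  obtain ⟨j, -, hj⟩ := hR.exists_atLevel h
  refine hR.mono ((hR.level_le_sum hj).trans ?_) hj.1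
  have := (hR.nonempty h).card_pos
  interval_cases X.card <;> simp

omit [Fintype Q] in
/-- A map that merges two states of a set sends triples with these states to pairs. -/
theorem merged_within {c r : ℕ} {f : Q → Q} {X Y : Finset Q} {p q : Q}
    (hX : R r (X.image f)) (hm : ∀ Y ⊆ X, ∀ j, R j (Y.image f) → R (j + 1) Y)
    (k : ℕ) (hk : ∀ Z, R r Z → Z.card ≤ k → R c Z)
    (hp : p ∈ Y) (hq : q ∈ Y) (hpq : p ≠ q) (hf : f p = f q) (hY : Y ⊆ X) (hYc : Y.card = k + 1) :
    R (c + 1) Y := by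
  refine hm Y hY c (hk _ (hR.subset hX (Finset.image_subset_image hY) (Finset.Nonempty.image ⟨p, hp⟩ _)) ?_)
  have := Finset.card_image_lt_of_eq hp hq hpq hf
  omega

/-- If a set of four states synchronizes, then two triples are synchronized fast. -/
theorem exists_low_triples {r : ℕ} {X : Finset Q} (h : R r X) (hX : X.card = 4) :
    ∃ U V : Finset Q, U ≠ V ∧ U.card = 3 ∧ V.card = 3 ∧
      R ((Fintype.card Q).choose 2 + 1) U ∧ R ((Fintype.card Q).choose 2 + 1) V := by
  classical
  -- Take a quad on the lowest possible level. Its first letter must merge two states, because the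
  -- image would otherwise be a lower quad.
  have hex : ∃ m, ∃ Y : Finset Q, R m Y ∧ Y.card = 4 := ⟨r, X, h, hX⟩
  obtain ⟨Y, hY, hYc⟩ := Nat.find_spec hex
  have hmin := fun m => @Nat.find_min _ _ hex m
  set m := Nat.find hex
  rcases Nat.eq_zero_or_pos m with h0 | hpos
  · rw [h0, hR.zero_iff] at hY
    omega
  obtain ⟨m', hm'⟩ : ∃ m', m = m' + 1 := ⟨m - 1, by omega⟩
  rw [hm'] at hY
  obtain ⟨f, hf, hm⟩ := hR.step hY fun hY' => hmin m' (by omega) ⟨Y, hY', hYc⟩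
  have hlt : (Y.image f).card < Y.card :=
    lt_of_le_of_ne Finset.card_image_le fun hc => hmin m' (by omega) ⟨_, hf, by omega⟩
  obtain ⟨p, hp, q, hq, hpq, hfpq⟩ := Finset.exists_ne_map_eq_of_card_lt_of_maps_to hlt
    (fun a ha => Finset.mem_image_of_mem f ha)
  have h2 : ((Y.erase p).erase q).card = 2 := by
    rw [Finset.card_erase_of_mem (by simp [hq, hpq.symm]), Finset.card_erase_of_mem hp, hYc]
  obtain ⟨x, y, hxy, he⟩ := Finset.card_eq_two.mp h2
  have hx : x ∈ (Y.erase p).erase q := by simp [he]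
  have hy : y ∈ (Y.erase p).erase q := by simp [he]
  simp only [Finset.mem_erase] at hx hy
  have hc : ∀ z, z ≠ p → z ≠ q → ({p, q, z} : Finset Q).card = 3 := fun z hzp hzq =>
    Finset.card_eq_three.mpr ⟨p, q, z, hpq, hzp.symm, hzq.symm, rfl⟩
  have hR3 : ∀ z ∈ Y, z ≠ p → z ≠ q → R ((Fintype.card Q).choose 2 + 1) {p, q, z} :=
    fun z hz hzp hzq => hR.merged_within hf hm 2 (fun Z hZ hZc => hR.pair_within hZ hZc)
      (by simp) (by simp) hpq hfpq (by simp [Finset.insert_subset_iff, *]) (hc z hzp hzq)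
  refine ⟨{p, q, x}, {p, q, y}, fun heq => ?_, hc x hx.2.1 hx.1, hc y hy.2.1 hy.1,
    hR3 x hx.2.2 hx.2.1 hx.1, hR3 y hy.2.2 hy.2.1 hy.1⟩
  have : x ∈ ({p, q, y} : Finset Q) := by rw [← heq]; simp
  simp [hx.1, hx.2.1, hxy] at this

/-- Here 7 = C(4,2) + 1: pairs and two of the four triples are not above level 7. Only two triples
and the full set are left for the levels above it, and 7 + 3 = 10. -/
theorem level_le_of_card_four (hQ : Fintype.card Q = 4) {r : ℕ} {X : Finset Q}
    (h : AtLevel R r X) (hX : X.card = 4) : r ≤ 10 := by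
  obtain ⟨U, V, hUV, hU, hV, hRU, hRV⟩ := hR.exists_low_triples h.1 hX
  rw [hQ] at hRU hRV
  norm_num [Nat.choose] at hRU hRV
  have := hR.sub_le_card (i := 7) h
    (insert Finset.univ (((Finset.powersetCard 3 .univ).erase U).erase V)) (by
      intro Y j hj _ hY hc
      have h2 := hR.two_le_card hY (by omega)
      have h3 : Y.card ≠ 2 := fun h3 => by
        have := hR.atLevel_le hY (hR.pair_within hY.1 h3.le)
        rw [hQ] at this
        norm_num [Nat.choose] at this
        omega
      rcases Nat.lt_or_ge Y.card 4 with h4 | h4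
      · refine Finset.mem_insert_of_mem ?_
        simp only [Finset.mem_erase, Finset.mem_powersetCard_univ]
        refine ⟨?_, ?_, by omega⟩ <;> rintro rfl
        · have := hR.atLevel_le hY hRV
          omega
        · have := hR.atLevel_le hY hRU
          omega
      · rw [(Finset.card_eq_iff_eq_univ Y).mp (by omega)]
        exact Finset.mem_insert_self _ _)
  have hc : (((Finset.powersetCard 3 (Finset.univ : Finset Q)).erase U).erase V).card = 2 := by
    rw [Finset.card_erase_of_mem (by simp [hV, hUV.symm]), Finset.card_erase_of_mem (by simp [hU]),
      Finset.card_powersetCard, Finset.card_univ, hQ]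
    rfl
  have := Finset.card_insert_le Finset.univ
    (((Finset.powersetCard 3 (Finset.univ : Finset Q)).erase U).erase V)
  omega

end Layering

/-! ### n = 5: quads when a smaller set does not synchronize -/

namespace Layering

variable {R : ℕ → Finset (Fin 5) → Prop} (hR : Layering R)
include hR

theorem pair_within_ten {r : ℕ} {X : Finset (Fin 5)} (h : R r X) (hc : X.card ≤ 2) : R 10 X := by
  simpa [Nat.choose] using hR.pair_within h hc

/-- Enlarge `T` to a triple `W`. Neither `W` nor a quad containing it synchronizes, which leaves the
quads that omit a state of `W`, at most three. Above level 11 = C(5,2) + 1 there are also at most 10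
- 3 triples, without `W` and the two low ones. Hence r ≤ 11 + 7 + 3. -/
theorem level_lt_of_not_sync {r : ℕ} {X T : Finset (Fin 5)} (h : AtLevel R r X) (hX : X.card = 4)
    (hT : ∀ j, ¬ R j T) (hT1 : T.Nonempty) (hT3 : T.card ≤ 3) : r < 22 := by
  obtain ⟨W, hTW, -, hWc⟩ := Finset.exists_subsuperset_card_eq (Finset.subset_univ T) hT3 (by simp)
  have hW : ∀ j, ¬ R j W := fun j hj => hT j (hR.subset hj hTW hT1)
  obtain ⟨U, V, hUV, hU, hV, hRU, hRV⟩ := hR.exists_low_triples h.1 hX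
  norm_num [Nat.choose] at hRU hRV
  have := hR.sub_le_card (i := 11) h
    ((((Finset.powersetCard 3 .univ).erase W).erase U).erase V ∪ W.image fun v => Finset.univ.erase v)
    (by
      intro Y j hj _ hY hc
      have h2 := hR.two_le_card hY (by omega)
      have h3 : Y.card ≠ 2 := fun h3 => by
        have := hR.atLevel_le hY (hR.pair_within_ten hY.1 h3.le)
        omega
      rcases Nat.lt_or_ge Y.card 4 with h4 | h4
      · refine Finset.mem_union_left _ ?_
        simp only [Finset.mem_erase, Finset.mem_powersetCard_univ]
        refine ⟨?_, ?_, ?_, by omega⟩ <;> rintro rfl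
        · have := hR.atLevel_le hY hRV
          omega
        · have := hR.atLevel_le hY hRU
          omega
        · exact hW _ hY.1
      · refine Finset.mem_union_right _ ?_
        have hYc : Yᶜ.card = 1 := by
          rw [Finset.card_compl, Fintype.card_fin]
          omega
        obtain ⟨v, hv⟩ := Finset.card_eq_one.mp hYc
        have hYv : Y = Finset.univ.erase v := by
          rw [← compl_compl Y, hv]
          ext
          simp
        refine Finset.mem_image.mpr ⟨v, ?_, hYv.symm⟩
        by_contra hvW
        refine hW j (hR.subset hY.1 ?_ (Finset.card_pos.mp (by omega)))
        intro w hw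
        rw [hYv]
        exact Finset.mem_erase.mpr ⟨fun hwv => hvW (hwv ▸ hw), Finset.mem_univ _⟩)
  have hc : ((((Finset.powersetCard 3 (Finset.univ : Finset (Fin 5))).erase W).erase U).erase
      V).card = 7 := by
    have hUW : U ≠ W := fun he => hW _ (he ▸ hRU)
    have hVW : V ≠ W := fun he => hW _ (he ▸ hRV)
    rw [Finset.card_erase_of_mem (by simp [hV, hUV.symm, hVW]),
      Finset.card_erase_of_mem (by simp [hU, hUW]), Finset.card_erase_of_mem (by simp [hWc]),
      Finset.card_powersetCard, Finset.card_univ, Fintype.card_fin]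
    rfl
  have h1 := Finset.card_union_le
    ((((Finset.powersetCard 3 (Finset.univ : Finset (Fin 5))).erase W).erase U).erase V)
    (W.image fun v => Finset.univ.erase v)
  have h2 : (W.image fun v => Finset.univ.erase v).card ≤ W.card := Finset.card_image_le
  omega

end Layering

theorem card_triples_without (p q : Fin 5) (h : p ≠ q) :
    ((Finset.powersetCard 3 Finset.univ).filter fun U : Finset (Fin 5) => ¬ (p ∈ U ∧ q ∈ U)).card
      = 7 := by
  revert p q
  decide +kernel

theorem eq_erase_of_card_four {Y : Finset (Fin 5)} (h : Y.card = 4) : ∃ v, Y = Finset.univ.erase v := by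
  have hYc : Yᶜ.card = 1 := by rw [Finset.card_compl, Fintype.card_fin, h]
  obtain ⟨v, hv⟩ := Finset.card_eq_one.mp hYc
  exact ⟨v, by rw [← compl_compl Y, hv]; ext; simp⟩

/-! ### n = 5: the full set of states -/

namespace Layering

variable {R : ℕ → Finset (Fin 5) → Prop} (hR : Layering R)
include hR

/-- The first letter merges some p and q. The three triples containing both are within level 11, so
the seven others (`G`) bound all triples by level 18. The quads containing both p and q are then
within level 19, and only the two quads omitting p or q can be higher. This gives 22 at once;
excluding 22 requires comparing the preimages of triples under the letter that leaves level 20. -/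
theorem level_univ_le {r : ℕ} (h : AtLevel R r Finset.univ) : r ≤ 21 := by
  classical
  by_contra! hr
  obtain ⟨l, rfl⟩ : ∃ l, r = l + 1 := ⟨r - 1, by omega⟩
  obtain ⟨f, hf, hm⟩ := hR.exists_step h
  set S := Finset.univ.image f with hS
  have hall : ∀ Y : Finset (Fin 5), Y.Nonempty → R (l + 1) Y := fun Y hY =>
    hR.subset h.1 (Finset.subset_univ Y) hY
  have hpair : ∀ {j} {Y : Finset (Fin 5)}, AtLevel R j Y → 10 < j → 3 ≤ Y.card := by
    intro j Y hY hj
    by_contra! hc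
    have := hR.atLevel_le hY (hR.pair_within_ten hY.1 (by omega))
    omega
  have hSc : S.card < 5 := by
    refine lt_of_le_of_ne (by simpa using Finset.card_le_univ S) fun hc => ?_
    rw [(Finset.card_eq_iff_eq_univ S).mp (by simpa using hc)] at hf
    have := hR.atLevel_unique h hf
    omega
  obtain ⟨p, -, q, -, hpq, hfpq⟩ := Finset.exists_ne_map_eq_of_card_lt_of_maps_to
    (s := (Finset.univ : Finset (Fin 5))) (t := S) (by simpa using hSc)
    (fun a ha => Finset.mem_image_of_mem f ha)
  have hlow : ∀ U : Finset (Fin 5), U.card = 3 → p ∈ U → q ∈ U → R 11 U := fun U hU hp hq =>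
    hR.merged_within hf.1 hm 2 (fun Z hZ hZc => hR.pair_within_ten hZ hZc) hp hq hpq hfpq
      (Finset.subset_univ U) hU
  set G := (Finset.powersetCard 3 Finset.univ).filter fun U : Finset (Fin 5) => ¬ (p ∈ U ∧ q ∈ U)
    with hG
  have hGc : G.card = 7 := card_triples_without p q hpq
  have hmemG : ∀ {j} {Y : Finset (Fin 5)}, AtLevel R j Y → 11 < j → Y.card ≤ 3 → Y ∈ G := by
    intro j Y hY hj hc
    have := hpair hY (by omega)
    refine Finset.mem_filter.mpr ⟨by simp; omega, fun hpqY => ?_⟩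
    have := hR.atLevel_le hY (hlow Y (by omega) hpqY.1 hpqY.2)
    omega
  have htriple : ∀ U : Finset (Fin 5), U.Nonempty → U.card ≤ 3 → R 18 U := by
    intro U hU hUc
    obtain ⟨j, -, hj⟩ := hR.exists_atLevel (hall U hU)
    refine hR.mono ?_ hj.1
    have := hR.sub_le_card (i := 11) hj G fun Y i hi _ hY hc => hmemG hY hi (by omega)
    omega
  have hquad : ∀ k, 10 ≤ k → (∀ U : Finset (Fin 5), U.Nonempty → U.card ≤ 3 → R k U) →
      ∀ Y j, AtLevel R j Y → k + 1 < j → Y.card ≤ 4 →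
        Y ∈ ({Finset.univ.erase p, Finset.univ.erase q} : Finset (Finset (Fin 5))) := by
    intro k hk hkU Y j hY hj hc
    have hne := hR.nonempty hY.1
    have hc4 : Y.card = 4 := by
      by_contra hc4
      have := hR.atLevel_le hY (hkU Y hne (by omega))
      omega
    obtain ⟨v, rfl⟩ := eq_erase_of_card_four hc4
    by_contra hv
    have hv' : p ≠ v ∧ q ≠ v := by
      constructor <;> rintro rfl <;> simp at hv
    have := hR.atLevel_le hY (hR.merged_within hf.1 hm 3
      (fun Z hZ hZc => hkU Z (hR.nonempty hZ) hZc) (by simpa using hv'.1) (by simpa using hv'.2)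
      hpq hfpq (Finset.subset_univ _) hc4)
    omega
  have hbound : ∀ k, 10 ≤ k → (∀ U : Finset (Fin 5), U.Nonempty → U.card ≤ 3 → R k U) →
      l ≤ k + 3 := by
    intro k hk hkU
    have := hR.sub_le_card (i := k + 1) hf _ fun Y j hj _ hY hc =>
      hquad k hk hkU Y j hY hj (by omega)
    have := Finset.card_le_two (a := Finset.univ.erase p) (b := Finset.univ.erase q)
    omega
  obtain rfl : l = 21 := by
    have := hbound 18 (by norm_num) htriple
    omega
  -- If all triples were within level 17, the count of quads would improve by one. So some triple is
  -- on level 18.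
  obtain ⟨U, hU, hUc, hU17⟩ : ∃ U : Finset (Fin 5), U.Nonempty ∧ U.card ≤ 3 ∧ ¬ R 17 U := by
    by_contra! hcon
    have := hbound 17 (by norm_num) hcon
    omega
  -- Levels 13 to 18 take up six of the seven triples in `G`.
  have hslow : (G.filter fun U => R 12 U).card ≤ 1 := by
    have := hR.sub_le_card (i := 12) (hR.atLevel_of_not (htriple U hU hUc) hU17)
      (G.filter fun U => ¬ R 12 U) (by
        intro Y j hj _ hY hc
        refine Finset.mem_filter.mpr ⟨hmemG hY (by omega) (by omega), fun h12 => ?_⟩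
        have := hR.atLevel_le hY h12
        omega)
    have := Finset.card_filter_add_card_filter_not (s := G) (fun U => R 12 U)
    omega
  -- The quads `S` and `W`, on levels 21 and 20, are those omitting p or q. The set on level 19 is a
  -- third quad, as triples are within 18, so it contains both p and q.
  obtain ⟨W, hW, hWc⟩ := hR.exists_atLevel_of_le hf (show 20 ≤ 21 by norm_num)
  obtain ⟨g, hg, hgm⟩ := hR.exists_step hW
  have hS2 := hquad 18 (by norm_num) htriple S 21 hf (by norm_num) (by omega)
  have hW2 := hquad 18 (by norm_num) htriple W 20 hW (by norm_num) (by omega)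
  have hSW : S ≠ W := fun he => by
    have := hR.atLevel_unique hf (he ▸ hW)
    omega
  have hSV : S ≠ W.image g := fun he => by
    have := hR.atLevel_unique hf (he ▸ hg)
    omega
  have hWV : W ≠ W.image g := fun he => by
    have := hR.atLevel_unique hW (he.symm.subst (motive := AtLevel R 19) hg)
    omega
  simp only [Finset.mem_insert, Finset.mem_singleton] at hS2 hW2
  have hWcard : W.card = 4 := by
    rcases hW2 with hW2 | hW2 <;> rw [hW2] <;> simp
  have hVcard : (W.image g).card = 4 := by
    have h4 : (W.image g).card ≤ W.card := Finset.card_image_le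
    by_contra hV4
    have := hR.atLevel_le hg (htriple _ (hR.nonempty hg.1) (by omega))
    omega
  obtain ⟨v, hv⟩ := eq_erase_of_card_four hVcard
  have hpv : p ≠ v := by
    rintro rfl
    rcases hS2 with h1 | h1 <;> rcases hW2 with h2 | h2
    · exact hSW (h1.trans h2.symm)
    · exact hSV (h1.trans hv.symm)
    · exact hWV (h2.trans hv.symm)
    · exact hSW (h1.trans h2.symm)
  have hqv : q ≠ v := by
    rintro rfl
    rcases hS2 with h1 | h1 <;> rcases hW2 with h2 | h2
    · exact hSW (h1.trans h2.symm)
    · exact hWV (h2.trans hv.symm)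
    · exact hSV (h1.trans hv.symm)
    · exact hSW (h1.trans h2.symm)
  -- Triples through p and q are within 11, so their preimages in `W` are within 12. These preimages
  -- are in `G`, because `W` omits p or q. Two such triples in the quad on level 19 give two
  -- different preimages, against `hslow`.
  have hpre : ∀ Z ⊆ W.image g, Z.card = 3 → p ∈ Z → q ∈ Z →
      ∃ Y ∈ G.filter fun U => R 12 U, Y.image g = Z := by
    intro Z hZ hZc hpZ hqZ
    obtain ⟨Y, hYW, hYZ, hYc⟩ := Finset.exists_subset_image_eq (hVcard.trans hWcard.symm) hZ
    refine ⟨Y, Finset.mem_filter.mpr ⟨Finset.mem_filter.mpr ⟨by simp; omega, fun hpqY => ?_⟩, ?_⟩, hYZ⟩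
    · have h1 := hYW hpqY.1
      have h2 := hYW hpqY.2
      rcases hW2 with hW2 | hW2 <;> rw [hW2] at h1 h2 <;> simp at h1 h2
    · exact hgm Y hYW 11 (hYZ ▸ hlow Z hZc hpZ hqZ)
  obtain ⟨x, y, hxy, hxyv⟩ : ∃ x y : Fin 5, x ≠ y ∧
      (({p, q, x} : Finset (Fin 5)).card = 3 ∧ ({p, q, y} : Finset (Fin 5)).card = 3) ∧
      ({p, q, x} : Finset (Fin 5)) ⊆ Finset.univ.erase v ∧
      ({p, q, y} : Finset (Fin 5)) ⊆ Finset.univ.erase v ∧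
      ({p, q, x} : Finset (Fin 5)) ≠ {p, q, y} := by
    clear_value G S
    revert hpq hpv hqv
    clear * -
    revert p q v
    decide +kernel
  rw [← hv] at hxyv
  obtain ⟨Y₁, h₁, hi₁⟩ := hpre _ hxyv.2.1 hxyv.1.1 (by simp) (by simp)
  obtain ⟨Y₂, h₂, hi₂⟩ := hpre _ hxyv.2.2.1 hxyv.1.2 (by simp) (by simp)
  have := Finset.card_le_one.mp hslow Y₁ h₁ Y₂ h₂
  exact hxyv.2.2.2 (by rw [← hi₁, ← hi₂, this])

end Layering

/-! ### n = 5, quads: definition of the exhaustive search -/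

/-! The following search is evaluated by the kernel. It is therefore written with recursors, in
continuation-passing style, on sets of states that are coded as numbers. It distributes the pairs and
the triples of five states over the levels, where the tables of the maps between the quads on the
highest levels are filtered on the way. -/

namespace SetSearch

/-- `k n`, with `n` brought to normal form before `k` is unfolded. -/
noncomputable def strict {β : Type} (n : ℕ) (k : ℕ → β) : β := Nat.rec (k 0) (fun m _ => k (Nat.succ m)) n

noncomputable def both (a b : Bool) : Bool := Bool.rec false b a

noncomputable def either (a b : Bool) : Bool := Bool.rec b true a

noncomputable def neg (a : Bool) : Bool := Bool.rec true false a

noncomputable def allOf {α : Type} (p : α → Bool) (l : List α) : Bool :=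
  List.rec true (fun a _ ih => Bool.rec false ih (p a)) l

noncomputable def anyOf {α : Type} (p : α → Bool) (l : List α) : Bool :=
  List.rec false (fun a _ ih => Bool.rec ih true (p a)) l

/-- Pass the elements of `l` that satisfy `p` to the continuation `k`, in reverse order. -/
noncomputable def sift {α β : Type} (p : α → Bool) (l : List α) (k : List α → β) : β :=
  List.rec (motive := fun _ => List α → β) k
    (fun a _ ih acc => Bool.rec (ih acc) (ih (a :: acc)) (p a)) l []

/-- `true` if `l` is empty, and `b` otherwise. -/
noncomputable def orEmpty {α : Type} (l : List α) (b : Bool) : Bool := List.rec true (fun _ _ _ => b) l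

/-- Check `p` for all sublists of `l` of length one and, if the budget is positive, of length two,
which cost one unit of the budget. -/
noncomputable def picks {α : Type} (budget : ℕ) (p : List α → ℕ → Bool) (l : List α) : Bool :=
  Nat.rec (allOf (fun a => p [a] 0) l)
    (fun n _ => List.rec true
      (fun a t ih => both (p [a] (Nat.succ n)) (both (allOf (fun b => p [a, b] n) t) ih)) l) budget

noncomputable def hasBit (F n : ℕ) : Bool := Nat.beq (Nat.land (Nat.shiftRight F n) 1) 1

/-- The `n`-th entry of a packed table of five-bit numbers. -/
noncomputable def field (m n : ℕ) : ℕ := Nat.land (Nat.shiftRight m (Nat.mul 5 n)) 31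

/-- Codes of the pairs; a set of states `S ⊆ {0, …, 4}` has the code `∑ i ∈ S, 2 ^ i`. -/
noncomputable def pairCodes : List ℕ := [3, 5, 6, 9, 10, 12, 17, 18, 20, 24]

structure Triangle where
  code : ℕ
  edge₁ : ℕ
  edge₂ : ℕ
  edge₃ : ℕ

noncomputable def triangles : List Triangle :=
  [⟨7, 3, 5, 6⟩, ⟨11, 3, 9, 10⟩, ⟨13, 5, 9, 12⟩, ⟨14, 6, 10, 12⟩, ⟨19, 3, 17, 18⟩,
   ⟨21, 5, 17, 20⟩, ⟨22, 6, 18, 20⟩, ⟨25, 9, 17, 24⟩, ⟨26, 10, 18, 24⟩, ⟨28, 12, 20, 24⟩]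

noncomputable def tripleCodes : List ℕ := triangles.map Triangle.code

noncomputable def codeOf (l : List ℕ) : ℕ := l.foldr (fun i s => Nat.lor (Nat.pow 2 i) s) 0

/-- The code of the preimage of the set with code `n` under the map with the given graph. -/
noncomputable def preimageCode (l : List (ℕ × ℕ)) (n : ℕ) : ℕ :=
  l.foldr (fun p s => bif hasBit n p.2 then Nat.lor (Nat.pow 2 p.1) s else s) 0

/-- The table of the preimages of pairs and triples under the map with the given graph. -/
noncomputable def pack (l : List (ℕ × ℕ)) : ℕ :=
  (pairCodes ++ tripleCodes).foldr
    (fun n s => Nat.add (Nat.shiftLeft (preimageCode l n) (Nat.mul 5 n)) s) 0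

noncomputable def states : List ℕ := [0, 1, 2, 3, 4]

/-- The tables of the maps from the set `src` onto the set with code `tgt`. -/
noncomputable def ontoTables (src : List ℕ) (tgt : ℕ) : List ℕ :=
  ((states.flatMap fun a => states.flatMap fun b => states.flatMap fun c =>
    states.map fun d => [a, b, c, d]).filter (fun v => Nat.beq (codeOf v) tgt)).map
      (fun v => pack (src.zip v))

/-- A set `{p, q, x, y}` of which `p` and `q` are merged. -/
structure MergeSource where
  pq : ℕ
  px : ℕ
  qx : ℕ
  py : ℕ
  qy : ℕ
  xy : ℕ
  pqx : ℕ
  pqy : ℕ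

noncomputable def mergeSource (p q x y : ℕ) : MergeSource :=
  ⟨codeOf [p, q], codeOf [p, x], codeOf [q, x], codeOf [p, y], codeOf [q, y], codeOf [x, y],
    codeOf [p, q, x], codeOf [p, q, y]⟩

/-- The image `{P, X, Y}` of a merged set. -/
structure MergeImage where
  PX : ℕ
  PY : ℕ
  XY : ℕ
  PXY : ℕ

noncomputable def mergeImages : List MergeImage :=
  states.flatMap fun P => states.flatMap fun X => states.flatMap fun Y =>
    bif either (Nat.beq P X) (either (Nat.beq P Y) (Nat.beq X Y)) then []
    else [⟨codeOf [P, X], codeOf [P, Y], codeOf [X, Y], codeOf [P, X, Y]⟩]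

/-- With `new` the sets on the previous level and `F` the sets within the current one, this says
that the preimages are delayed by at most one level. -/
noncomputable def compatible (F : ℕ) (new : List ℕ) (m : ℕ) : Bool := allOf (fun e => hasBit F (field m e)) new

/-- Remove the incompatible tables from every list. The result is `true` if a list becomes empty. -/
noncomputable def refine (F : ℕ) (new : List ℕ) (q : List (List ℕ)) (k : List (List ℕ) → Bool) : Bool :=
  List.rec (motive := fun _ => List (List ℕ) → Bool) k
    (fun l _ ih acc => sift (compatible F new) l fun l' => orEmpty l' (ih (l' :: acc))) q []

noncomputable def addBits (F : ℕ) (new : List ℕ) : ℕ :=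
  List.rec F (fun e _ ih => Nat.lor (Nat.shiftLeft 1 e) ih) new

noncomputable def setLevels (lv r : ℕ) (new : List ℕ) : ℕ :=
  List.rec lv (fun e _ ih => Nat.lor (Nat.shiftLeft r (Nat.mul 5 e)) ih) new

noncomputable def almostLe (i j : ℕ) : Bool := Nat.ble i (Nat.succ j)

/-- Some permutation of the second triple dominates the first up to one. -/
noncomputable def almostDominated (a b c x y z : ℕ) : Bool :=
  either (both (almostLe a x) (either (both (almostLe b y) (almostLe c z)) (both (almostLe b z) (almostLe c y))))
  (either (both (almostLe a y) (either (both (almostLe b x) (almostLe c z)) (both (almostLe b z) (almostLe c x))))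
    (both (almostLe a z) (either (both (almostLe b x) (almostLe c y)) (both (almostLe b y) (almostLe c x)))))

noncomputable def edgeLevels (lv : ℕ) (t : Triangle) (k : ℕ → ℕ → ℕ → Bool) : Bool :=
  strict (field lv t.edge₁) fun a => strict (field lv t.edge₂) fun b =>
    strict (field lv t.edge₃) fun c => k a b c

/-- A letter that maps a triple bijectively onto a triple of the previous level matches their edges,
and each edge is at most one level later than its image. -/
noncomputable def canStep (lv : ℕ) (prev : List Triangle) (t : Triangle) : Bool :=
  edgeLevels lv t fun a b c => anyOf (fun y => edgeLevels lv y (almostDominated a b c)) prev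

noncomputable def codes (l : List Triangle) : List ℕ := List.rec [] (fun t _ ih => t.code :: ih) l

/-- Add the triples `new` on one level. -/
noncomputable def addTriples (F : ℕ) (prev : List Triangle) (qs : List (List ℕ))
    (next : ℕ → ℕ → List Triangle → List (List ℕ) → Bool) (new : List Triangle) (budget : ℕ) :
    Bool :=
  strict (addBits F (codes new)) fun F' =>
    refine F' (codes prev) qs fun qs' => next budget F' new qs'

/-- Refute all ways to distribute the remaining triples over the levels from `r` on. -/
noncomputable def tripleSearch (lv : ℕ) (ts : List MergeImage) (fuel : ℕ) :
    ℕ → ℕ → ℕ → List Triangle → List (List ℕ) → Bool :=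
  Nat.rec (motive := fun _ => ℕ → ℕ → ℕ → List Triangle → List (List ℕ) → Bool)
    (fun _ _ _ prev _ => allOf (fun t => allOf (fun e => neg (Nat.beq e.code t.PXY)) prev) ts)
    (fun _ ih r budget F prev qs =>
      sift (fun t => both (neg (hasBit F t.code)) (either (Nat.ble r 11) (canStep lv prev t)))
        triangles fun pool => picks budget (addTriples F prev qs (ih (Nat.succ r))) pool) fuel

/-- Passes from pairs to triples; both low triples {p,q,x} and {p,q,y} are within level `ρ`. In the
tight case there is no other triple within `ρ`. In the loose case one triple is spare: it is either
a tie on a later level (budget 1) or a third triple within `ρ`. -/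
noncomputable def baseSearch (s : MergeSource) (ρ : ℕ) (loose : Bool) (lv F : ℕ) (qs : List (List ℕ))
    (ts : List MergeImage) : Bool :=
  sift (fun t => neg (both (Nat.ble (field lv t.PX) (Nat.sub ρ 2))
      (Nat.ble (field lv t.PY) (Nat.sub ρ 2)))) ts fun ts' =>
    orEmpty ts' (sift (fun t => either (Nat.beq t.code s.pqx) (Nat.beq t.code s.pqy)) triangles
      fun low => strict (addBits F (codes low)) fun F' =>
        Bool.rec (tripleSearch lv ts' 8 (Nat.succ ρ) 0 F' low qs)
          (both (tripleSearch lv ts' 7 (Nat.succ ρ) 1 F' low qs)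
            (sift (fun t => neg (hasBit F' t.code)) triangles fun rest =>
              allOf (fun v => strict (addBits F' [v.code]) fun F'' =>
                tripleSearch lv ts' 7 (Nat.succ ρ) 0 F'' (v :: low) qs) rest)) loose)

/-- If {P,X} is on the previous level, then {p,q,x} is within level `r`, and so are its edges;
likewise for Y. The flag `strong` forbids {P,X} and {P,Y} on levels up to 6. -/
noncomputable def imageOk (s : MergeSource) (r : ℕ) (strong : Bool) (F : ℕ) (prev : List ℕ) (t : MergeImage) :
    Bool :=
  allOf (fun e => both
    (Bool.rec true (both (neg (both strong (Nat.ble r 7))) (both (hasBit F s.px) (hasBit F s.qx)))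
      (Nat.beq e t.PX)) (both
    (Bool.rec true (both (neg (both strong (Nat.ble r 7))) (both (hasBit F s.py) (hasBit F s.qy)))
      (Nat.beq e t.PY))
    (Bool.rec true (hasBit F s.xy) (Nat.beq e t.XY)))) prev

/-- Add the pairs `new` on level `r`. On the last level, the budget must be used up. -/
noncomputable def addPairs (s : MergeSource) (strong last : Bool) (r lv F : ℕ) (prev : List ℕ)
    (qs : List (List ℕ)) (ts : List MergeImage)
    (next : ℕ → ℕ → ℕ → List ℕ → List (List ℕ) → List MergeImage → Bool) (new : List ℕ)
    (budget : ℕ) : Bool :=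
  either (both last (Nat.ble 1 budget)) (strict (addBits F new) fun F' =>
    either (neg (hasBit F' s.pq)) (refine F' prev qs fun qs' =>
      sift (imageOk s r strong F' prev) ts fun ts' => orEmpty ts'
        (strict (setLevels lv r new) fun lv' => next budget lv' F' new qs' ts')))

/-- Refute all ways to distribute the remaining pairs over the levels from `r` on. -/
noncomputable def pairSearch (s : MergeSource) (ρ : ℕ) (loose strong : Bool) (fuel : ℕ) :
    ℕ → ℕ → ℕ → ℕ → List ℕ → List (List ℕ) → List MergeImage → Bool :=
  Nat.rec (motive := fun _ => ℕ → ℕ → ℕ → ℕ → List ℕ → List (List ℕ) → List MergeImage → Bool)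
    (fun _ _ lv F _ qs ts => baseSearch s ρ loose lv F qs ts)
    (fun n ih r budget lv F prev qs ts =>
      sift (fun t => neg (hasBit F t)) pairCodes fun pool =>
        picks budget (addPairs s strong (Nat.beq n 0) r lv F prev qs ts (ih (Nat.succ r))) pool)
    fuel

/-- The sets with at most one element. -/
noncomputable def smallSets : ℕ := 65815

noncomputable def normalize {β : Type} (l : List ℕ) (k : List ℕ → β) : β :=
  List.rec (motive := fun _ => List ℕ → β) k
    (fun a _ ih acc => strict a fun a' => ih (a' :: acc)) l []

noncomputable def normalizeImages {β : Type} (l : List MergeImage) (k : List MergeImage → β) : β :=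
  List.rec (motive := fun _ => List MergeImage → β) k
    (fun t _ ih acc => strict t.PX fun a => strict t.PY fun b => strict t.XY fun c =>
      strict t.PXY fun d => ih (⟨a, b, c, d⟩ :: acc)) l []

noncomputable def normalizeSource {β : Type} (s : MergeSource) (k : MergeSource → β) : β :=
  strict s.pq fun a => strict s.px fun b => strict s.qx fun c => strict s.py fun d =>
    strict s.qy fun e => strict s.xy fun f => strict s.pqx fun g => strict s.pqy fun h =>
      k ⟨a, b, c, d, e, f, g, h⟩

/-- Ten pairs with at least one new pair on each of `c` levels leave a surplus of 10 - c for ties.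
-/
noncomputable def search (c ρ : ℕ) (loose strong : Bool) (ss : List MergeSource) (q : List (List ℕ)) : Bool :=
  List.rec (motive := fun _ => List (List ℕ) → Bool)
    (fun q' => normalizeImages mergeImages fun ts => allOf (fun s => normalizeSource s fun s' =>
      pairSearch s' ρ loose strong c 1 (Nat.sub 10 c) 0 smallSets [] q' ts) ss)
    (fun l _ ih q' => normalize l fun l' => ih (l' :: q')) q []

noncomputable def tightSources : List MergeSource :=
  [mergeSource 2 3 1 4, mergeSource 2 4 1 3, mergeSource 3 4 1 2]

noncomputable def allSources : List MergeSource :=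
  [mergeSource 1 2 3 4, mergeSource 1 3 2 4, mergeSource 1 4 2 3] ++ tightSources

/-- The codes 30, 29, 27, 23 stand for the quads omitting 0, 1, 2, 3. Each list consists of the
candidates for the map from one quad of the chain onto the quad below it. -/
noncomputable def fourTables : List (List ℕ) :=
  [ontoTables [0, 2, 3, 4] 30, ontoTables [0, 1, 3, 4] 29, ontoTables [0, 1, 2, 4] 27]

noncomputable def fiveTables : List (List ℕ) := ontoTables [0, 1, 2, 3] 23 :: fourTables

end SetSearch

/-! ### Specification of the search primitives -/

namespace SetSearch

theorem strict_eq {β : Type} (n : ℕ) (k : ℕ → β) : strict n k = k n := by cases n <;> rfl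

theorem both_iff {a b : Bool} : both a b = true ↔ a = true ∧ b = true := by
  cases a <;> cases b <;> simp [both]

theorem either_iff {a b : Bool} : either a b = true ↔ a = true ∨ b = true := by
  cases a <;> cases b <;> simp [either]

theorem neg_iff {a : Bool} : neg a = true ↔ ¬ a = true := by cases a <;> simp [neg]

theorem allOf_iff {α : Type} {p : α → Bool} {l : List α} :
    allOf p l = true ↔ ∀ a ∈ l, p a = true := by
  induction l with
  | nil => simp [allOf]
  | cons a l ih =>
    have : allOf p (a :: l) = both (p a) (allOf p l) := rfl
    rw [this, both_iff, ih, List.forall_mem_cons]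

theorem anyOf_iff {α : Type} {p : α → Bool} {l : List α} :
    anyOf p l = true ↔ ∃ a ∈ l, p a = true := by
  induction l with
  | nil => simp [anyOf]
  | cons a l ih =>
    have : anyOf p (a :: l) = either (p a) (anyOf p l) := rfl
    rw [this, either_iff, ih, List.exists_mem_cons_iff]

theorem sift_spec {α β : Type} (p : α → Bool) (l : List α) (k : List α → β) :
    ∃ l', (∀ a, a ∈ l' ↔ a ∈ l ∧ p a = true) ∧ sift p l k = k l' := by
  have key : ∀ acc : List α, ∃ l', (∀ a, a ∈ l' ↔ a ∈ acc ∨ a ∈ l ∧ p a = true) ∧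
      List.rec (motive := fun _ => List α → β) k
        (fun a _ ih acc => Bool.rec (ih acc) (ih (a :: acc)) (p a)) l acc = k l' := by
    induction l with
    | nil => exact fun acc => ⟨acc, by simp, rfl⟩
    | cons a l ih =>
      intro acc
      cases hp : p a with
      | false =>
        obtain ⟨l', h, he⟩ := ih acc
        refine ⟨l', fun b => ?_, by simp only [hp]; exact he⟩
        rw [h, List.mem_cons]
        constructor
        · rintro (hb | hb)
          exacts [.inl hb, .inr ⟨.inr hb.1, hb.2⟩]
        · rintro (hb | ⟨rfl | hb, hb'⟩)
          exacts [.inl hb, by simp [hp] at hb', .inr ⟨hb, hb'⟩]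
      | true =>
        obtain ⟨l', h, he⟩ := ih (a :: acc)
        refine ⟨l', fun b => ?_, by simp only [hp]; exact he⟩
        rw [h, List.mem_cons, List.mem_cons]
        constructor
        · rintro ((rfl | hb) | hb)
          exacts [.inr ⟨.inl rfl, hp⟩, .inl hb, .inr ⟨.inr hb.1, hb.2⟩]
        · rintro (hb | ⟨rfl | hb, hb'⟩)
          exacts [.inl (.inr hb), .inl (.inl rfl), .inr ⟨hb, hb'⟩]
  obtain ⟨l', h, he⟩ := key []
  exact ⟨l', by simpa using h, he⟩

theorem orEmpty_of_mem {α : Type} {l : List α} {a : α} (h : a ∈ l) (b : Bool) :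
    orEmpty l b = b := by
  cases l with
  | nil => simp at h
  | cons => rfl

theorem picks_one {α : Type} {budget : ℕ} {p : List α → ℕ → Bool} {l : List α}
    (h : picks budget p l = true) {a : α} (ha : a ∈ l) : p [a] budget = true := by
  cases budget with
  | zero => exact allOf_iff.mp h a ha
  | succ n =>
    induction l with
    | nil => simp at ha
    | cons b l ih =>
      have h' : both (p [b] (n + 1)) (both (allOf (fun c => p [b, c] n) l) (picks (n + 1) p l))
        = true := h
      rw [both_iff, both_iff] at h'
      rcases List.mem_cons.mp ha with rfl | ha
      · exact h'.1
      · exact ih ha h'.2.2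

theorem picks_two {α : Type} {n : ℕ} {p : List α → ℕ → Bool} {l : List α}
    (h : picks (n + 1) p l = true) {a b : α} (ha : a ∈ l) (hb : b ∈ l) (hab : a ≠ b) :
    p [a, b] n = true ∨ p [b, a] n = true := by
  induction l with
  | nil => simp at ha
  | cons c l ih =>
    have h' : both (p [c] (n + 1)) (both (allOf (fun d => p [c, d] n) l) (picks (n + 1) p l))
      = true := h
    rw [both_iff, both_iff, allOf_iff] at h'
    rcases List.mem_cons.mp ha with rfl | ha' <;> rcases List.mem_cons.mp hb with rfl | hb'
    · exact absurd rfl hab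
    · exact .inl (h'.2.1 b hb')
    · exact .inr (h'.2.1 a ha')
    · exact ih h'.2.2 ha' hb'

theorem hasBit_eq (F n : ℕ) : hasBit F n = F.testBit n := by
  rw [Nat.testBit_eq_decide_div_mod_eq, ← Nat.shiftRight_eq_div_pow]
  change Nat.beq ((F >>> n) &&& 1) 1 = _
  rw [Nat.and_one_is_mod, Bool.eq_iff_iff, Nat.beq_eq, decide_eq_true_eq]

theorem testBit_field (m n i : ℕ) : (field m n).testBit i = (m.testBit (5 * n + i) && decide (i < 5)) := by
  change ((m >>> (5 * n)) &&& (2 ^ 5 - 1)).testBit i = _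
  rw [Nat.testBit_and, Nat.testBit_shiftRight, Nat.testBit_two_pow_sub_one]

theorem field_or (a b n : ℕ) : field (Nat.lor a b) n = field a n ||| field b n := by
  refine Nat.eq_of_testBit_eq fun i => ?_
  change (field (a ||| b) n).testBit i = _
  rw [Nat.testBit_or, testBit_field, testBit_field, testBit_field, Nat.testBit_or,
    Bool.and_or_distrib_right]

theorem field_shiftLeft {r : ℕ} (hr : r < 32) (e n : ℕ) :
    field (Nat.shiftLeft r (Nat.mul 5 e)) n = if n = e then r else 0 := by
  refine Nat.eq_of_testBit_eq fun i => ?_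
  change (field (r <<< (5 * e)) n).testBit i = _
  rw [testBit_field, Nat.testBit_shiftLeft]
  have hr' : ∀ k, 5 ≤ k → r.testBit k = false := fun k hk =>
    Nat.testBit_lt_two_pow (hr.trans_le (Nat.pow_le_pow_right (n := 2) (by norm_num) hk))
  split_ifs with h
  · subst h
    by_cases hi : i < 5
    · simp [hi]
    · simp [hi, hr' i (by omega)]
  · by_cases hi : i < 5
    · by_cases hle : 5 * e ≤ 5 * n + i
      · simp [hr' (5 * n + i - 5 * e) (by omega)]
      · simp [hle]
    · simp [hi]

theorem testBit_addBits (F : ℕ) (new : List ℕ) (n : ℕ) :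
    (addBits F new).testBit n = true ↔ F.testBit n = true ∨ n ∈ new := by
  induction new with
  | nil => simp [addBits]
  | cons a l ih =>
    have : addBits F (a :: l) = (1 <<< a) ||| addBits F l := rfl
    rw [this, Nat.testBit_or, Nat.one_shiftLeft, Nat.testBit_two_pow, Bool.or_eq_true, ih,
      decide_eq_true_eq, List.mem_cons]
    tauto

/-- Levels are written by a bitwise or, so a field must be zero before it is written. -/
theorem field_setLevels (lv : ℕ) {r : ℕ} (hr : r < 32) (new : List ℕ) (n : ℕ) (h : n ∈ new → field lv n = 0) :
    field (setLevels lv r new) n = if n ∈ new then r else field lv n := by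
  induction new with
  | nil => simp [setLevels]
  | cons a l ih =>
    have : setLevels lv r (a :: l) =
      Nat.lor (Nat.shiftLeft r (Nat.mul 5 a)) (setLevels lv r l) := rfl
    rw [this, field_or, field_shiftLeft hr, ih fun hn => h (List.mem_cons_of_mem a hn)]
    by_cases h1 : n = a
    · subst h1
      have h0 := h (by simp)
      by_cases h2 : n ∈ l <;> simp [h2, h0]
    · simp [h1]

/-- A list that holds a table of an actual map never becomes empty, so `orEmpty` does not cut the
search short and the continuation is reached. -/
theorem refine_spec {F : ℕ} {new : List ℕ} {Good : ℕ → Prop}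
    (hG : ∀ m, Good m → compatible F new m = true) {q : List (List ℕ)}
    (hq : ∀ l ∈ q, ∃ m ∈ l, Good m) (k : List (List ℕ) → Bool) :
    ∃ q', (∀ l ∈ q', ∃ m ∈ l, Good m) ∧ refine F new q k = k q' := by
  have key : ∀ acc : List (List ℕ), (∀ l ∈ acc, ∃ m ∈ l, Good m) →
      ∃ q', (∀ l ∈ q', ∃ m ∈ l, Good m) ∧
      List.rec (motive := fun _ => List (List ℕ) → Bool) k
        (fun l _ ih acc => sift (compatible F new) l fun l' => orEmpty l' (ih (l' :: acc))) q acc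
        = k q' := by
    induction q with
    | nil => exact fun acc h => ⟨acc, h, rfl⟩
    | cons l q ih =>
      intro acc hacc
      obtain ⟨m, hm, hgood⟩ := hq l (by simp)
      obtain ⟨l', hl', he⟩ := sift_spec (compatible F new) l fun l' =>
        orEmpty l' (List.rec (motive := fun _ => List (List ℕ) → Bool) k
          (fun l _ ih acc => sift (compatible F new) l fun l' => orEmpty l' (ih (l' :: acc))) q
          (l' :: acc))
      have hml : m ∈ l' := (hl' m).mpr ⟨hm, hG m hgood⟩
      obtain ⟨q', hq', he'⟩ := ih (fun l hl => hq l (List.mem_cons_of_mem _ hl)) (l' :: acc)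
        (by
          intro a ha
          rcases List.mem_cons.mp ha with rfl | ha
          exacts [⟨m, hml, hgood⟩, hacc a ha])
      exact ⟨q', hq', he.trans ((orEmpty_of_mem hml _).trans he')⟩
  exact key [] (by simp)

theorem mem_codes {l : List Triangle} {n : ℕ} : n ∈ codes l ↔ ∃ t ∈ l, t.code = n := by
  induction l with
  | nil => simp [codes]
  | cons a l ih =>
    have : codes (a :: l) = a.code :: codes l := rfl
    rw [this, List.mem_cons, ih, List.exists_mem_cons_iff, eq_comm]

theorem normalize_spec {β : Type} (l : List ℕ) (k : List ℕ → β) :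
    ∃ l', (∀ a, a ∈ l' ↔ a ∈ l) ∧ normalize l k = k l' := by
  have key : ∀ acc : List ℕ, ∃ l', (∀ a, a ∈ l' ↔ a ∈ acc ∨ a ∈ l) ∧
      List.rec (motive := fun _ => List ℕ → β) k
        (fun a _ ih acc => strict a fun a' => ih (a' :: acc)) l acc = k l' := by
    induction l with
    | nil => exact fun acc => ⟨acc, by simp, rfl⟩
    | cons a l ih =>
      intro acc
      obtain ⟨l', h, he⟩ := ih (a :: acc)
      exact ⟨l', fun b => by rw [h]; simp only [List.mem_cons]; tauto, (strict_eq _ _).trans he⟩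
  obtain ⟨l', h, he⟩ := key []
  exact ⟨l', by simpa using h, he⟩

theorem normalizeImages_spec {β : Type} (l : List MergeImage) (k : List MergeImage → β) :
    ∃ l', (∀ a, a ∈ l' ↔ a ∈ l) ∧ normalizeImages l k = k l' := by
  have key : ∀ acc : List MergeImage, ∃ l', (∀ a, a ∈ l' ↔ a ∈ acc ∨ a ∈ l) ∧
      List.rec (motive := fun _ => List MergeImage → β) k
        (fun t _ ih acc => strict t.PX fun a => strict t.PY fun b => strict t.XY fun c =>
          strict t.PXY fun d => ih (⟨a, b, c, d⟩ :: acc)) l acc = k l' := by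
    induction l with
    | nil => exact fun acc => ⟨acc, by simp, rfl⟩
    | cons a l ih =>
      intro acc
      obtain ⟨l', h, he⟩ := ih (a :: acc)
      refine ⟨l', fun b => by rw [h]; simp only [List.mem_cons]; tauto, ?_⟩
      simpa only [strict_eq] using he
  obtain ⟨l', h, he⟩ := key []
  exact ⟨l', by simpa using h, he⟩

theorem normalizeSource_eq {β : Type} (s : MergeSource) (k : MergeSource → β) :
    normalizeSource s k = k s := by
  simp only [normalizeSource, strict_eq]

theorem search_spec {c ρ : ℕ} {loose strong : Bool} {ss : List MergeSource} {q : List (List ℕ)}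
    (h : search c ρ loose strong ss q = true) :
    ∃ q' ts, (∀ l' ∈ q', ∃ l ∈ q, ∀ a, a ∈ l' ↔ a ∈ l) ∧ (∀ t, t ∈ ts ↔ t ∈ mergeImages) ∧
      ∀ s ∈ ss, pairSearch s ρ loose strong c 1 (10 - c) 0 smallSets [] q' ts = true := by
  have key : ∀ (q acc : List (List ℕ)),
      List.rec (motive := fun _ => List (List ℕ) → Bool)
        (fun q' => normalizeImages mergeImages fun ts => allOf (fun s => normalizeSource s fun s' =>
          pairSearch s' ρ loose strong c 1 (Nat.sub 10 c) 0 smallSets [] q' ts) ss)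
        (fun l _ ih q' => normalize l fun l' => ih (l' :: q')) q acc = true →
      ∃ q' ts, (∀ l' ∈ q', l' ∈ acc ∨ ∃ l ∈ q, ∀ a, a ∈ l' ↔ a ∈ l) ∧
        (∀ t, t ∈ ts ↔ t ∈ mergeImages) ∧
        ∀ s ∈ ss, pairSearch s ρ loose strong c 1 (10 - c) 0 smallSets [] q' ts = true := by
    intro q
    induction q with
    | nil =>
      intro acc h
      obtain ⟨ts, hts, he⟩ := normalizeImages_spec mergeImages fun ts =>
        allOf (fun s => normalizeSource s fun s' =>
          pairSearch s' ρ loose strong c 1 (Nat.sub 10 c) 0 smallSets [] acc ts) ss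
      have h' := he.symm.trans h
      rw [allOf_iff] at h'
      refine ⟨acc, ts, fun l hl => .inl hl, hts, fun s hs => ?_⟩
      have := h' s hs
      rwa [normalizeSource_eq] at this
    | cons l q ih =>
      intro acc h
      obtain ⟨l', hl', he⟩ := normalize_spec l fun l' =>
        List.rec (motive := fun _ => List (List ℕ) → Bool)
          (fun q' => normalizeImages mergeImages fun ts => allOf (fun s => normalizeSource s fun s' =>
            pairSearch s' ρ loose strong c 1 (Nat.sub 10 c) 0 smallSets [] q' ts) ss)
          (fun l _ ih q' => normalize l fun l' => ih (l' :: q')) q (l' :: acc)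
      obtain ⟨q', ts, hq', hts, hs⟩ := ih (l' :: acc) (he.symm.trans h)
      refine ⟨q', ts, fun a ha => ?_, hts, hs⟩
      rcases hq' a ha with ha | ⟨b, hb, hab⟩
      · rcases List.mem_cons.mp ha with rfl | ha
        · exact .inr ⟨l, by simp, hl'⟩
        · exact .inl ha
      · exact .inr ⟨b, List.mem_cons_of_mem _ hb, hab⟩
  obtain ⟨q', ts, hq', hts, hs⟩ := key q [] h
  exact ⟨q', ts, fun l hl => by simpa using hq' l hl, hts, hs⟩

end SetSearch

/-! ### Soundness of the search -/

namespace SetSearch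

/-- If the set of chosen elements grows by few elements, `picks` considers these elements. -/
theorem picks_spec {α : Type} {budget : ℕ} (hb : budget ≤ 1) {p : List α → ℕ → Bool}
    {l : List α} (h : picks budget p l = true) {N : Finset α} (hN : N.Nonempty)
    (hNl : ∀ a ∈ N, a ∈ l) (hc : N.card ≤ budget + 1) :
    ∃ new b, (∀ a, a ∈ new ↔ a ∈ N) ∧ b + N.card = budget + 1 ∧ p new b = true := by
  have hpos := hN.card_pos
  rcases (show N.card = 1 ∨ N.card = 2 by omega) with h1 | h2
  · obtain ⟨a, rfl⟩ := Finset.card_eq_one.mp h1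
    exact ⟨[a], budget, by simp, by simp, picks_one h (hNl a (by simp))⟩
  · classical
    obtain ⟨a, b, hab, rfl⟩ := Finset.card_eq_two.mp h2
    obtain rfl : budget = 0 + 1 := by omega
    rcases picks_two h (hNl a (by simp)) (hNl b (by simp)) hab with h | h
    · exact ⟨[a, b], 0, by simp, by omega, h⟩
    · exact ⟨[b, a], 0, by simp [or_comm], by omega, h⟩

theorem card_add_sub_le {α : Type*} {P : ℕ → Finset α} {i b : ℕ} (hib : i ≤ b)
    (hP : ∀ j, i ≤ j → j < b → P j ⊂ P (j + 1)) : (P i).card + (b - i) ≤ (P b).card := by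
  induction b, hib using Nat.le_induction with
  | base => simp
  | succ b hib ih =>
    have h1 := ih fun j hj hjb => hP j hj (by omega)
    have h2 := Finset.card_lt_card (hP b hib (by omega))
    omega

/-- The preimages under the table `m` are later by at most one level. -/
structure GoodTable (V : ℕ → ℕ → Prop) (m : ℕ) : Prop where
  pair : ∀ n ∈ pairCodes, ∀ j, V j n → smallSets.testBit (field m n) = true ∨
    field m n ∈ pairCodes ∧ V (j + 1) (field m n)
  triple : ∀ n ∈ tripleCodes, ∀ j, V j n → smallSets.testBit (field m n) = true ∨
    field m n ∈ pairCodes ∨ field m n ∈ tripleCodes ∧ V (j + 1) (field m n)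

/-- What is known about the image {P,X,Y} of the lowest quad under the letter merging p and q:
preimages are delayed by at most one level, and the image is on level `L`. The field `base` prevents
both low triples from being inferred within level ρ - 1. -/
structure GoodImage (V : ℕ → ℕ → Prop) (ρ L : ℕ) (strong : Bool) (s : MergeSource)
    (t : MergeImage) : Prop where
  PX_mem : t.PX ∈ pairCodes
  PY_mem : t.PY ∈ pairCodes
  PX : ∀ j, V j t.PX → V (j + 1) s.px ∧ V (j + 1) s.qx
  PY : ∀ j, V j t.PY → V (j + 1) s.py ∧ V (j + 1) s.qy
  XY : ∀ j, V j t.XY → V (j + 1) s.xy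
  PXY : ∃ y ∈ triangles, y.code = t.PXY ∧ V L y.code ∧ ¬ V (L - 1) y.code
  strong : strong = true → ¬ V 6 t.PX ∧ ¬ V 6 t.PY
  base : ¬ (V (ρ - 2) t.PX ∧ V (ρ - 2) t.PY)

/-- The edges of `t` are later than those of `y` by at most one level. -/
def Follows (V : ℕ → ℕ → Prop) (t : Triangle) (x y z : ℕ) : Prop :=
  ∀ j, (V j x → V (j + 1) t.edge₁) ∧ (V j y → V (j + 1) t.edge₂) ∧ (V j z → V (j + 1) t.edge₃)

/-- The six cases are the bijections between the edges of the two triples. -/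
def FollowsSome (V : ℕ → ℕ → Prop) (t y : Triangle) : Prop :=
  Follows V t y.edge₁ y.edge₂ y.edge₃ ∨ Follows V t y.edge₁ y.edge₃ y.edge₂ ∨
  Follows V t y.edge₂ y.edge₁ y.edge₃ ∨ Follows V t y.edge₂ y.edge₃ y.edge₁ ∨
  Follows V t y.edge₃ y.edge₁ y.edge₂ ∨ Follows V t y.edge₃ y.edge₂ y.edge₁

/-- The properties of the levels `V` of pairs and triples which are refuted by the search. -/
structure Branch (V : ℕ → ℕ → Prop) (c ρ L : ℕ) (s : MergeSource) : Prop where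
  succ : ∀ j n, V j n → V (j + 1) n
  zero : ∀ n ∈ pairCodes, ¬ V 0 n
  mem : s.pq ∈ pairCodes ∧ s.px ∈ pairCodes ∧ s.qx ∈ pairCodes ∧ s.py ∈ pairCodes ∧
    s.qy ∈ pairCodes ∧ s.xy ∈ pairCodes
  low_mem : ∃ t ∈ triangles, ∃ u ∈ triangles, t.code = s.pqx ∧ u.code = s.pqy ∧ t ≠ u
  merged : V 1 s.pq
  pairs : ∀ n ∈ pairCodes, V c n
  pair_new : ∀ j < c, ∃ n ∈ pairCodes, V (j + 1) n ∧ ¬ V j n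
  le : c ≤ 10
  low : V ρ s.pqx ∧ V ρ s.pqy
  triple_new : ∀ j, ρ ≤ j → j < L → ∃ t ∈ triangles, V (j + 1) t.code ∧ ¬ V j t.code
  step : ∀ j, 11 ≤ j → j < L → ∀ t ∈ triangles, V (j + 1) t.code → ¬ V j t.code →
    ∃ y ∈ triangles, V j y.code ∧ ¬ V (j - 1) y.code ∧ FollowsSome V t y

theorem not_mem_tripleCodes_of_mem_pairCodes {n : ℕ} (h : n ∈ pairCodes) : n ∉ tripleCodes := by
  revert n
  decide +kernel

theorem not_mem_small {n : ℕ} (h : smallSets.testBit n = true) : n ∉ pairCodes ++ tripleCodes := by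
  have key : ∀ n ∈ pairCodes ++ tripleCodes, smallSets.testBit n = false := by decide +kernel
  intro hn
  simp [key n hn] at h

theorem edges_mem {t : Triangle} (h : t ∈ triangles) :
    t.edge₁ ∈ pairCodes ∧ t.edge₂ ∈ pairCodes ∧ t.edge₃ ∈ pairCodes := by
  simp only [triangles, List.mem_cons, List.not_mem_nil, or_false] at h
  rcases h with h | h | h | h | h | h | h | h | h | h <;> subst h <;> simp [pairCodes]

theorem eq_of_code_eq {t u : Triangle} (ht : t ∈ triangles) (hu : u ∈ triangles)
    (h : t.code = u.code) : t = u := by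
  simp only [triangles, List.mem_cons, List.not_mem_nil, or_false] at ht hu
  rcases ht with ht | ht | ht | ht | ht | ht | ht | ht | ht | ht <;> subst ht <;>
    rcases hu with hu | hu | hu | hu | hu | hu | hu | hu | hu | hu <;> subst hu <;> simp_all

theorem code_mem {t : Triangle} (h : t ∈ triangles) : t.code ∈ tripleCodes :=
  List.mem_map_of_mem h

variable {V : ℕ → ℕ → Prop} {c ρ L : ℕ} {s : MergeSource} {strong : Bool} {t : MergeImage}

open Classical in
/-- The triples with levels at most `j`. -/
noncomputable def triplesWithin (V : ℕ → ℕ → Prop) (j : ℕ) : Finset Triangle :=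
  triangles.toFinset.filter (V j ·.code)

open Classical in
/-- The pairs with levels at most `j`. -/
noncomputable def pairsWithin (V : ℕ → ℕ → Prop) (j : ℕ) : Finset ℕ := pairCodes.toFinset.filter (V j)

theorem card_triplesWithin_le (V : ℕ → ℕ → Prop) (j : ℕ) : (triplesWithin V j).card ≤ 10 := by
  classical
  exact (Finset.card_filter_le _ _).trans (List.toFinset_card_le _)

theorem card_pairsWithin_le (V : ℕ → ℕ → Prop) (j : ℕ) : (pairsWithin V j).card ≤ 10 := by
  classical
  exact (Finset.card_filter_le _ _).trans (List.toFinset_card_le _)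

theorem mem_triplesWithin {j : ℕ} {y : Triangle} :
    y ∈ triplesWithin V j ↔ y ∈ triangles ∧ V j y.code := by simp [triplesWithin]

theorem mem_pairsWithin {j n : ℕ} : n ∈ pairsWithin V j ↔ n ∈ pairCodes ∧ V j n := by
  simp [pairsWithin]

namespace Branch

variable (B : Branch V c ρ L s)
include B

theorem mono {i j n : ℕ} (hij : i ≤ j) (h : V i n) : V j n := by
  induction hij with
  | refl => exact h
  | step _ ih => exact B.succ _ _ ih

theorem pair_ssubset {j : ℕ} (hj : j < c) :
    (pairsWithin V j) ⊂ pairsWithin V (j + 1) := by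
  obtain ⟨n, hn, h1, h0⟩ := B.pair_new j hj
  refine (Finset.ssubset_iff_of_subset fun a ha => ?_).mpr ⟨n, by simp [mem_pairsWithin, hn, h1], by simp [mem_pairsWithin, h0]⟩
  rw [mem_pairsWithin] at ha ⊢
  exact ⟨ha.1, B.succ _ _ ha.2⟩

theorem triple_ssubset {j : ℕ} (hj : ρ ≤ j) (hL : j < L) :
    triplesWithin V j ⊂ triplesWithin V (j + 1) := by
  obtain ⟨n, hn, h1, h0⟩ := B.triple_new j hj hL
  refine (Finset.ssubset_iff_of_subset fun a ha => ?_).mpr ⟨n, by simp [mem_triplesWithin, hn, h1], by simp [mem_triplesWithin, h0]⟩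
  rw [mem_triplesWithin] at ha ⊢
  exact ⟨ha.1, B.succ _ _ ha.2⟩

theorem card_triple_le {j : ℕ} (hj : ρ ≤ j) (hL : j ≤ L) :
    (triplesWithin V j).card + (L - j) ≤ 10 := by
  refine (card_add_sub_le (P := fun j => triplesWithin V j) hL
    fun k hk hkL => B.triple_ssubset (by omega) hkL).trans (card_triplesWithin_le _ _)

theorem card_pair_le {j : ℕ} (hj : j ≤ c) :
    (pairsWithin V j).card + (c - j) ≤ 10 := by
  refine (card_add_sub_le (P := fun j => pairsWithin V j) hj
    fun k hk hkL => B.pair_ssubset hkL).trans (card_pairsWithin_le _ _)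

end Branch

/-- The table `lv` contains the levels of all pairs. -/
def HasLevels (V : ℕ → ℕ → Prop) (lv : ℕ) : Prop := ∀ n ∈ pairCodes, ∀ j, V j n ↔ field lv n ≤ j

theorem HasLevels.le_succ {lv m n : ℕ} (h : HasLevels V lv) (hm : m ∈ pairCodes) (hn : n ∈ pairCodes)
    (hV : ∀ j, V j m → V (j + 1) n) : almostLe (field lv n) (field lv m) = true :=
  Nat.ble_eq.mpr ((h n hn _).mp (hV _ ((h m hm _).mpr le_rfl)))

theorem canStep_of_followsSome {lv : ℕ} (h : HasLevels V lv) {prev : List Triangle} {t y : Triangle}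
    (ht : t ∈ triangles) (hy : y ∈ triangles) (hp : y ∈ prev) (hf : FollowsSome V t y) :
    canStep lv prev t = true := by
  obtain ⟨ht1, ht2, ht3⟩ := edges_mem ht
  obtain ⟨hy1, hy2, hy3⟩ := edges_mem hy
  simp only [canStep, edgeLevels, strict_eq, anyOf_iff]
  refine ⟨y, hp, ?_⟩
  simp only [almostDominated, either_iff, both_iff]
  have key : ∀ a ∈ pairCodes, ∀ b ∈ pairCodes, ∀ d ∈ pairCodes, Follows V t a b d →
      almostLe (field lv t.edge₁) (field lv a) = true ∧
      almostLe (field lv t.edge₂) (field lv b) = true ∧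
      almostLe (field lv t.edge₃) (field lv d) = true := fun a ha b hb d hd hf =>
    ⟨h.le_succ ha ht1 fun j => (hf j).1, h.le_succ hb ht2 fun j => (hf j).2.1,
      h.le_succ hd ht3 fun j => (hf j).2.2⟩
  rcases hf with hf | hf | hf | hf | hf | hf
  · have := key _ hy1 _ hy2 _ hy3 hf; tauto
  · have := key _ hy1 _ hy3 _ hy2 hf; tauto
  · have := key _ hy2 _ hy1 _ hy3 hf; tauto
  · have := key _ hy2 _ hy3 _ hy1 hf; tauto
  · have := key _ hy3 _ hy1 _ hy2 hf; tauto
  · have := key _ hy3 _ hy2 _ hy1 hf; tauto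

/-- `F` contains the small sets, the pairs, and the triples with levels at most `j`. -/
structure TripleTrack (V : ℕ → ℕ → Prop) (F j : ℕ) : Prop where
  small : ∀ n, smallSets.testBit n = true → F.testBit n = true
  pair : ∀ n ∈ pairCodes, F.testBit n = true
  triple : ∀ n ∈ tripleCodes, F.testBit n = true ↔ V j n

theorem TripleTrack.compatible {F j : ℕ} (hF : TripleTrack V F (j + 1)) {m : ℕ} (hm : GoodTable V m)
    {l : List ℕ} (hl : ∀ n ∈ l, n ∈ tripleCodes ∧ V j n) : compatible F l m = true := by
  simp only [SetSearch.compatible, allOf_iff, hasBit_eq]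
  intro n hn
  obtain ⟨h1, h2⟩ := hl n hn
  rcases hm.triple n h1 j h2 with h | h | h
  exacts [hF.small _ h, hF.pair _ h, (hF.triple _ h.1).mpr h.2]

/-- Follow the branch of the search that agrees with the actual levels. The budget is the number of
triples that remain after reserving one for each level up to `L`. The branch survives to the end,
where the image triple of the lowest quad is found on level `L`, so the search returns `false`. -/
theorem tripleSearch_eq_false (B : Branch V c ρ L s) {lv : ℕ} (hlv : HasLevels V lv)
    (ht : GoodImage V ρ L strong s t) {ts : List MergeImage} (hts : t ∈ ts) (fuel : ℕ) :
    ∀ {j budget F : ℕ} {prev : List Triangle} {qs : List (List ℕ)}, 10 ≤ j → ρ ≤ j →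
      j + fuel = L → budget ≤ 1 →
      budget + fuel + (triplesWithin V j).card = 10 → TripleTrack V F j →
      (∀ y ∈ prev, y ∈ triangles ∧ V j y.code) →
      (∀ y ∈ triangles, V j y.code → ¬ V (j - 1) y.code → y ∈ prev) →
      (∀ l ∈ qs, ∃ m ∈ l, GoodTable V m) →
      tripleSearch lv ts fuel (j + 1) budget F prev qs = true → False := by
  classical
  induction fuel with
  | zero =>
    intro j budget F prev qs _ _ hj _ _ _ _ hprev' _ h
    have h' : allOf (fun t => allOf (fun e => neg (Nat.beq e.code t.PXY)) prev) ts = true := h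
    obtain ⟨y, hy, hyt, h1, h0⟩ := ht.PXY
    obtain rfl : j = L := by omega
    have := allOf_iff.mp (allOf_iff.mp h' t hts) y (hprev' y hy h1 h0)
    rw [neg_iff, Nat.beq_eq] at this
    exact this hyt
  | succ n ih =>
    intro j budget F prev qs h10 hρ hj hb hcount hF hprev hprev' hqs h
    have h' : sift (fun t => both (neg (hasBit F t.code))
        (either (Nat.ble (j + 1) 11) (canStep lv prev t))) triangles (fun pool =>
        picks budget (addTriples F prev qs (tripleSearch lv ts n (j + 1 + 1))) pool) = true := h
    obtain ⟨pool, hpool, he⟩ := sift_spec (fun t => both (neg (hasBit F t.code))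
        (either (Nat.ble (j + 1) 11) (canStep lv prev t))) triangles (fun pool =>
        picks budget (addTriples F prev qs (tripleSearch lv ts n (j + 1 + 1))) pool)
    rw [he] at h'
    have hss := B.triple_ssubset hρ (by omega : j < L)
    have hle := B.card_triple_le (j := j + 1) (by omega) (by omega)
    have hcard := Finset.card_sdiff_add_card_eq_card hss.subset
    set N := triplesWithin V (j + 1) \ triplesWithin V j
      with hN
    have hpos : 0 < N.card := (Finset.sdiff_nonempty.mpr hss.2).card_pos
    have memN : ∀ y, y ∈ N ↔ y ∈ triangles ∧ V (j + 1) y.code ∧ ¬ V j y.code := by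
      intro y
      simp only [N, Finset.mem_sdiff, mem_triplesWithin]
      tauto
    obtain ⟨new, b, hnew, hbN, hp⟩ := picks_spec hb h' (N := N)
      (Finset.card_pos.mp hpos) (by
        intro y hy
        obtain ⟨hyt, h1, h0⟩ := (memN y).mp hy
        rw [hpool, both_iff, neg_iff, hasBit_eq, hF.triple _ (code_mem hyt), either_iff]
        refine ⟨hyt, h0, ?_⟩
        -- A triple on a level up to 11 may step to a pair, so the comparison of edges starts at
        -- level 12.
        by_cases hj11 : j + 1 ≤ 11
        · exact .inl (Nat.ble_eq.mpr hj11)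
        · obtain ⟨z, hz, hz1, hz0, hf⟩ := B.step j (by omega) (by omega) y hyt h1 h0
          exact .inr (canStep_of_followsSome hlv hyt hz (hprev' z hz hz1 hz0) hf)) (by omega)
    rw [addTriples, strict_eq] at hp
    have hF' : TripleTrack V (addBits F (codes new)) (j + 1) := by
      refine ⟨fun n hn => ?_, fun n hn => ?_, fun n hn => ?_⟩
      · rw [testBit_addBits]; exact .inl (hF.small n hn)
      · rw [testBit_addBits]; exact .inl (hF.pair n hn)
      · rw [testBit_addBits, hF.triple n hn, mem_codes]
        constructor
        · rintro (h | ⟨y, hy, rfl⟩)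
          · exact B.succ _ _ h
          · exact ((memN y).mp ((hnew y).mp hy)).2.1
        · intro h1
          by_cases h0 : V j n
          · exact .inl h0
          · obtain ⟨y, hy, rfl⟩ := List.mem_map.mp hn
            exact .inr ⟨y, (hnew y).mpr ((memN y).mpr ⟨hy, h1, h0⟩), rfl⟩
    obtain ⟨qs', hqs', he'⟩ := refine_spec (F := addBits F (codes new)) (new := codes prev)
      (Good := GoodTable V) (fun m hm => hF'.compatible hm (by
        intro n hn
        obtain ⟨y, hy, rfl⟩ := mem_codes.mp hn
        exact ⟨code_mem (hprev y hy).1, (hprev y hy).2⟩)) hqs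
      (fun qs' => tripleSearch lv ts n (j + 1 + 1) b (addBits F (codes new)) new qs')
    rw [he'] at hp
    refine ih (by omega) (by omega) (by omega) (by omega) (by omega) hF' ?_ ?_ hqs' hp
    · intro y hy
      have := (memN y).mp ((hnew y).mp hy)
      exact ⟨this.1, this.2.1⟩
    · exact fun y hy h1 h0 => (hnew y).mpr ((memN y).mpr ⟨hy, h1, h0⟩)

/-- `F` contains the small sets, and the pairs with levels at most `j`. -/
structure PairTrack (V : ℕ → ℕ → Prop) (F j : ℕ) : Prop where
  small : ∀ n, smallSets.testBit n = true → F.testBit n = true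
  pair : ∀ n ∈ pairCodes, F.testBit n = true ↔ V j n
  triple : ∀ n ∈ tripleCodes, ¬ F.testBit n = true

open Classical in
theorem baseSearch_eq_false (B : Branch V c ρ L s) {lv F : ℕ} {loose : Bool} (h10 : 10 ≤ ρ)
    (hL : L = ρ + bif loose then 7 else 8) (hlv : HasLevels V lv) (hF : PairTrack V F c)
    (ht : GoodImage V ρ L strong s t) {ts : List MergeImage} (hts : t ∈ ts) {qs : List (List ℕ)}
    (hqs : ∀ l ∈ qs, ∃ m ∈ l, GoodTable V m) (h : baseSearch s ρ loose lv F qs ts = true) :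
    False := by
  rw [baseSearch] at h
  obtain ⟨ts', hts', he⟩ := sift_spec (fun t => neg (both (Nat.ble (field lv t.PX) (Nat.sub ρ 2))
      (Nat.ble (field lv t.PY) (Nat.sub ρ 2)))) ts fun ts' =>
    orEmpty ts' (sift (fun t => either (Nat.beq t.code s.pqx) (Nat.beq t.code s.pqy)) triangles
      fun low => strict (addBits F (codes low)) fun F' =>
        Bool.rec (motive := fun _ => Bool) (tripleSearch lv ts' 8 (Nat.succ ρ) 0 F' low qs)
          (both (tripleSearch lv ts' 7 (Nat.succ ρ) 1 F' low qs)
            (sift (fun t => neg (hasBit F' t.code)) triangles fun rest =>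
              allOf (fun v => strict (addBits F' [v.code]) fun F'' =>
                tripleSearch lv ts' 7 (Nat.succ ρ) 0 F'' (v :: low) qs) rest)) loose)
  rw [he] at h
  have htm : t ∈ ts' := by
    rw [hts', neg_iff, both_iff, Nat.ble_eq, Nat.ble_eq]
    refine ⟨hts, fun hn => ht.base ?_⟩
    exact ⟨(hlv _ ht.PX_mem _).mpr hn.1, (hlv _ ht.PY_mem _).mpr hn.2⟩
  rw [orEmpty_of_mem htm] at h
  clear he
  obtain ⟨low, hlow, he⟩ := sift_spec
    (fun t => either (Nat.beq t.code s.pqx) (Nat.beq t.code s.pqy)) triangles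
      fun low => strict (addBits F (codes low)) fun F' =>
        Bool.rec (motive := fun _ => Bool) (tripleSearch lv ts' 8 (Nat.succ ρ) 0 F' low qs)
          (both (tripleSearch lv ts' 7 (Nat.succ ρ) 1 F' low qs)
            (sift (fun t => neg (hasBit F' t.code)) triangles fun rest =>
              allOf (fun v => strict (addBits F' [v.code]) fun F'' =>
                tripleSearch lv ts' 7 (Nat.succ ρ) 0 F'' (v :: low) qs) rest)) loose
  rw [he, strict_eq] at h
  clear he
  simp only [either_iff, Nat.beq_eq] at hlow
  obtain ⟨u, hu, w, hw, hupq, hwpq, huw⟩ := B.low_mem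
  have hlow' : ∀ y, y ∈ low ↔ y = u ∨ y = w := by
    intro y
    rw [hlow]
    constructor
    · rintro ⟨hy, h | h⟩
      · exact .inl (eq_of_code_eq hy hu (h.trans hupq.symm))
      · exact .inr (eq_of_code_eq hy hw (h.trans hwpq.symm))
    · rintro (rfl | rfl)
      exacts [⟨hu, .inl hupq⟩, ⟨hw, .inr hwpq⟩]
  have hVu : V ρ u.code := hupq ▸ B.low.1
  have hVw : V ρ w.code := hwpq ▸ B.low.2
  set T := triplesWithin V ρ
  have memT : ∀ y, y ∈ T ↔ y ∈ triangles ∧ V ρ y.code := fun y => mem_triplesWithin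
  have hsub : ({u, w} : Finset Triangle) ⊆ T := by
    intro y hy
    simp only [Finset.mem_insert, Finset.mem_singleton] at hy
    rcases hy with rfl | rfl
    exacts [(memT _).mpr ⟨hu, hVu⟩, (memT _).mpr ⟨hw, hVw⟩]
  have hcard2 : ({u, w} : Finset Triangle).card = 2 := Finset.card_pair huw
  have hle : T.card + (L - ρ) ≤ 10 := B.card_triple_le le_rfl (show ρ ≤ L by omega)
  have track : ∀ l : List Triangle, (∀ y, y ∈ l ↔ y ∈ T) → ∀ F', (∀ n, F'.testBit n = true ↔
      F.testBit n = true ∨ n ∈ codes l) → TripleTrack V F' ρ := by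
    intro l hl F' hF'
    have hV : ∀ n, n ∈ codes l ↔ n ∈ tripleCodes ∧ V ρ n := by
      intro n
      rw [mem_codes]
      constructor
      · rintro ⟨y, hy, rfl⟩
        have := (memT y).mp ((hl y).mp hy)
        exact ⟨code_mem this.1, this.2⟩
      · rintro ⟨hn, hVn⟩
        obtain ⟨y, hy, rfl⟩ := List.mem_map.mp hn
        exact ⟨y, (hl y).mpr ((memT y).mpr ⟨hy, hVn⟩), rfl⟩
    refine ⟨fun n hn => (hF' n).mpr (.inl (hF.small n hn)),
      fun n hn => (hF' n).mpr (.inl ((hF.pair n hn).mpr (B.pairs n hn))), fun n hn => ?_⟩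
    rw [hF', hV]
    exact ⟨fun h => (h.resolve_left (hF.triple n hn)).2, fun h => .inr ⟨hn, h⟩⟩
  have final : ∀ (l : List Triangle) (F' fuel budget : ℕ), (∀ y, y ∈ l ↔ y ∈ T) →
      (∀ n, F'.testBit n = true ↔ F.testBit n = true ∨ n ∈ codes l) → ρ + fuel = L → budget ≤ 1 →
      budget + fuel + T.card = 10 → tripleSearch lv ts' fuel (ρ + 1) budget F' l qs = true →
      False := by
    intro l F' fuel budget hl hF' hfuel hb hcount hs
    refine tripleSearch_eq_false B hlv ht htm fuel h10 le_rfl hfuel hb hcount (track l hl F' hF')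
      (fun y hy => (memT y).mp ((hl y).mp hy)) (fun y hy h1 _ => (hl y).mpr ((memT y).mpr ⟨hy, h1⟩))
      hqs hs
  have hmem2 : T.card = 2 → ∀ y, y ∈ low ↔ y ∈ T := by
    intro h2 y
    rw [hlow', ← Finset.eq_of_subset_of_card_le hsub (by omega)]
    simp
  cases loose with
  | false =>
    simp only [cond_false] at hL
    have := Finset.card_le_card hsub
    have h2 : T.card = 2 := by omega
    exact final low _ 8 0 (hmem2 h2) (testBit_addBits F _) (by omega) (by omega) (by omega) h
  | true =>
    simp only [cond_true] at hL
    have := Finset.card_le_card hsub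
    obtain ⟨hA, hB⟩ := both_iff.mp h
    -- One new triple on each of the 7 levels above `ρ` leaves at most three within `ρ`.
    rcases (show T.card = 2 ∨ T.card = 3 by omega) with h2 | h3
    · exact final low _ 7 1 (hmem2 h2) (testBit_addBits F _) (by omega) (by omega) (by omega) hA
    · obtain ⟨v, hv⟩ := Finset.card_eq_one.mp
        (show (T \ {u, w}).card = 1 by rw [Finset.card_sdiff_of_subset hsub]; omega)
      have hTv : ∀ y, y ∈ T ↔ y = v ∨ y = u ∨ y = w := by
        intro y
        rw [← Finset.sdiff_union_of_subset hsub, hv]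
        simp only [Finset.mem_union, Finset.mem_singleton, Finset.mem_insert]
      have hvT : v ∈ T \ {u, w} := by rw [hv]; simp
      rw [Finset.mem_sdiff, Finset.mem_insert, Finset.mem_singleton] at hvT
      obtain ⟨rest, hrest, he⟩ := sift_spec
        (fun t => neg (hasBit (addBits F (codes low)) t.code)) triangles fun rest =>
              allOf (fun v => strict (addBits (addBits F (codes low)) [v.code]) fun F'' =>
                tripleSearch lv ts' 7 (Nat.succ ρ) 0 F'' (v :: low) qs) rest
      rw [he, allOf_iff] at hB
      have hvt := ((memT v).mp hvT.1).1
      have hvr : v ∈ rest := by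
        rw [hrest, neg_iff, hasBit_eq, testBit_addBits, mem_codes]
        refine ⟨hvt, ?_⟩
        rintro (h | ⟨y, hy, hyv⟩)
        · exact hF.triple _ (code_mem hvt) h
        · have := eq_of_code_eq ((hlow y).mp hy).1 hvt hyv
          subst this
          exact hvT.2 ((hlow' _).mp hy)
      have := hB v hvr
      rw [strict_eq] at this
      refine final (v :: low) _ 7 0 (fun y => ?_) (fun n => ?_) (by omega) (by omega) (by omega) this
      · rw [hTv, List.mem_cons, hlow']
      · rw [testBit_addBits, testBit_addBits, List.mem_singleton]
        have : codes (v :: low) = v.code :: codes low := rfl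
        rw [this, List.mem_cons]
        tauto

theorem PairTrack.compatible {F j : ℕ} (hF : PairTrack V F (j + 1)) {m : ℕ} (hm : GoodTable V m)
    {l : List ℕ} (hl : ∀ n ∈ l, n ∈ pairCodes ∧ V j n) : compatible F l m = true := by
  simp only [SetSearch.compatible, allOf_iff, hasBit_eq]
  intro n hn
  obtain ⟨h1, h2⟩ := hl n hn
  rcases hm.pair n h1 j h2 with h | h
  exacts [hF.small _ h, (hF.pair _ h.1).mpr h.2]

theorem imageOk_of_goodImage (B : Branch V c ρ L s) (ht : GoodImage V ρ L strong s t) {F j : ℕ}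
    (hF : PairTrack V F (j + 1)) {prev : List ℕ} (hprev : ∀ n ∈ prev, n ∈ pairCodes ∧ V j n) :
    imageOk s (j + 1) strong F prev t = true := by
  obtain ⟨-, h1, h2, h3, h4, h5⟩ := B.mem
  have strong_of : ∀ n, V j n → (strong = true → ¬ V 6 n) →
      neg (both strong (Nat.ble (j + 1) 7)) = true := by
    intro n hn hs
    rw [neg_iff, both_iff, Nat.ble_eq]
    exact fun h => hs h.1 (B.mono (by omega) hn)
  have rec_true : ∀ {a b : Bool}, (b = true → a = true) → (Bool.rec true a b : Bool) = true := by
    intro a b h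
    cases b
    exacts [rfl, h rfl]
  simp only [imageOk, allOf_iff, both_iff]
  intro n hn
  have hV := (hprev n hn).2
  refine ⟨rec_true fun h => ?_, rec_true fun h => ?_, rec_true fun h => ?_⟩ <;>
    obtain rfl := Nat.eq_of_beq_eq_true h
  · rw [both_iff, both_iff, hasBit_eq, hasBit_eq, hF.pair _ h1, hF.pair _ h2]
    exact ⟨strong_of _ hV fun h => (ht.strong h).1, ht.PX j hV⟩
  · rw [both_iff, both_iff, hasBit_eq, hasBit_eq, hF.pair _ h3, hF.pair _ h4]
    exact ⟨strong_of _ hV fun h => (ht.strong h).2, ht.PY j hV⟩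
  · rw [hasBit_eq, hF.pair _ h5]
    exact ht.XY j hV

/-- Again the branch with the actual levels is followed. Invariants: `lv` has the exact levels of
the pairs placed so far and zeros for the others, and the budget is the number of pairs beyond one
for each remaining level. -/
theorem pairSearch_eq_false (B : Branch V c ρ L s) {loose : Bool} (h10 : 10 ≤ ρ)
    (hL : L = ρ + bif loose then 7 else 8)
    (ht : GoodImage V ρ L strong s t) (fuel : ℕ) :
    ∀ {j budget lv F : ℕ} {prev : List ℕ} {qs : List (List ℕ)} {ts : List MergeImage},
      j + fuel = c → budget ≤ 1 →
      budget + fuel + (pairsWithin V j).card = 10 → PairTrack V F j →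
      (∀ n ∈ pairCodes, V j n → ∀ i, V i n ↔ field lv n ≤ i) →
      (∀ n ∈ pairCodes, ¬ V j n → field lv n = 0) →
      (∀ n ∈ prev, n ∈ pairCodes ∧ V j n) → t ∈ ts →
      (∀ l ∈ qs, ∃ m ∈ l, GoodTable V m) →
      pairSearch s ρ loose strong fuel (j + 1) budget lv F prev qs ts = true → False := by
  classical
  induction fuel with
  | zero =>
    intro j budget lv F prev qs ts hj _ _ hF hlv _ _ hts hqs h
    obtain rfl : j = c := by omega
    exact baseSearch_eq_false B h10 hL (fun n hn => hlv n hn (B.pairs n hn)) hF ht hts hqs h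
  | succ n ih =>
    intro j budget lv F prev qs ts hj hb hcount hF hlv hlv0 hprev hts hqs h
    have h' : sift (fun t => neg (hasBit F t)) pairCodes (fun pool =>
        picks budget (addPairs s strong (Nat.beq n 0) (j + 1) lv F prev qs ts
          (pairSearch s ρ loose strong n (j + 1 + 1))) pool) = true := h
    obtain ⟨pool, hpool, he⟩ := sift_spec (fun t => neg (hasBit F t)) pairCodes (fun pool =>
        picks budget (addPairs s strong (Nat.beq n 0) (j + 1) lv F prev qs ts
          (pairSearch s ρ loose strong n (j + 1 + 1))) pool)
    rw [he] at h'
    have hss := B.pair_ssubset (by omega : j < c)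
    have hle := B.card_pair_le (j := j + 1) (by omega)
    have hcard := Finset.card_sdiff_add_card_eq_card hss.subset
    set N := (pairsWithin V (j + 1)) \ pairsWithin V j
    have hpos : 0 < N.card := (Finset.sdiff_nonempty.mpr hss.2).card_pos
    have memN : ∀ y, y ∈ N ↔ y ∈ pairCodes ∧ V (j + 1) y ∧ ¬ V j y := by
      intro y
      simp only [N, Finset.mem_sdiff, mem_pairsWithin]
      tauto
    obtain ⟨new, b, hnew, hbN, hp⟩ := picks_spec hb h' (N := N)
      (Finset.card_pos.mp hpos) (by
        intro y hy
        obtain ⟨hyt, h1, h0⟩ := (memN y).mp hy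
        rw [hpool, neg_iff, hasBit_eq, hF.pair _ hyt]
        exact ⟨hyt, h0⟩) (by omega)
    have hnew' : ∀ y, y ∈ new ↔ y ∈ pairCodes ∧ V (j + 1) y ∧ ¬ V j y :=
      fun y => (hnew y).trans (memN y)
    have hF' : PairTrack V (addBits F new) (j + 1) := by
      refine ⟨fun n hn => ?_, fun n hn => ?_, fun n hn => ?_⟩
      · rw [testBit_addBits]; exact .inl (hF.small n hn)
      · rw [testBit_addBits, hF.pair n hn, hnew']
        constructor
        · rintro (h | h)
          exacts [B.succ _ _ h, h.2.1]
        · intro h1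
          by_cases h0 : V j n
          exacts [.inl h0, .inr ⟨hn, h1, h0⟩]
      · rw [testBit_addBits, hnew']
        rintro (h | h)
        · exact hF.triple n hn h
        · exact not_mem_tripleCodes_of_mem_pairCodes h.1 hn
    -- On level `c` all ten pairs are placed, so no budget remains and the shortcut for the last
    -- level is not taken.
    have hlast : ¬ both (Nat.beq n 0) (Nat.ble 1 b) = true := by
      rw [both_iff, Nat.beq_eq, Nat.ble_eq]
      rintro ⟨rfl, hb1⟩
      obtain rfl : j + 1 = c := by omega
      have : pairsWithin V (j + 1) = pairCodes.toFinset :=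
        Finset.filter_true_of_mem fun n hn => B.pairs n (List.mem_toFinset.mp hn)
      rw [this] at hcard
      have h10 : pairCodes.toFinset.card = 10 := by
        rw [List.toFinset_card_of_nodup (by decide +kernel)]; rfl
      omega
    have hpq : ¬ neg (hasBit (addBits F new) s.pq) = true := by
      rw [neg_iff, hasBit_eq, hF'.pair _ B.mem.1, not_not]
      exact B.mono (by omega) B.merged
    rw [addPairs, either_iff, strict_eq, either_iff] at hp
    replace hp := (hp.resolve_left hlast).resolve_left hpq
    obtain ⟨qs', hqs', he'⟩ := refine_spec (F := addBits F new) (new := prev)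
      (Good := GoodTable V) (fun m hm => hF'.compatible hm hprev) hqs
      (fun qs' => sift (imageOk s (j + 1) strong (addBits F new) prev) ts fun ts' => orEmpty ts'
        (strict (setLevels lv (j + 1) new) fun lv' =>
          pairSearch s ρ loose strong n (j + 1 + 1) b lv' (addBits F new) new qs' ts'))
    rw [he'] at hp
    obtain ⟨ts', hts', he''⟩ := sift_spec (imageOk s (j + 1) strong (addBits F new) prev) ts
      (fun ts' => orEmpty ts'
        (strict (setLevels lv (j + 1) new) fun lv' =>
          pairSearch s ρ loose strong n (j + 1 + 1) b lv' (addBits F new) new qs' ts'))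
    have htm : t ∈ ts' := (hts' t).mpr ⟨hts, imageOk_of_goodImage B ht hF' hprev⟩
    rw [he'', orEmpty_of_mem htm, strict_eq] at hp
    have hfield : ∀ m ∈ pairCodes, field (setLevels lv (j + 1) new) m =
        if m ∈ new then j + 1 else field lv m := fun m hm =>
      field_setLevels lv (by have := B.le; omega) new m fun h => hlv0 m hm ((hnew' m).mp h).2.2
    refine ih (by omega) (by omega) (by omega) hF' ?_ ?_ ?_ htm hqs' hp
    · intro m hm h1 i
      rw [hfield m hm]
      by_cases h0 : V j m
      · rw [if_neg fun h => ((hnew' m).mp h).2.2 h0]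
        exact hlv m hm h0 i
      · rw [if_pos ((hnew' m).mpr ⟨hm, h1, h0⟩)]
        refine ⟨fun h => ?_, fun h => B.mono h h1⟩
        by_contra! hlt
        exact h0 (B.mono (by omega) h)
    · intro m hm h1
      rw [hfield m hm, if_neg fun h => h1 ((hnew' m).mp h).2.1]
      exact hlv0 m hm fun h => h1 (B.succ _ _ h)
    · intro m hm
      have := (hnew' m).mp hm
      exact ⟨this.1, this.2.1⟩

theorem search_ne_true (B : Branch V c ρ L s) {loose : Bool} {ss : List MergeSource}
    {q : List (List ℕ)} (h10 : 10 ≤ ρ) (hc : 9 ≤ c) (hL : L = ρ + bif loose then 7 else 8)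
    (ht : GoodImage V ρ L strong s t) (htm : t ∈ mergeImages) (hs : s ∈ ss)
    (hq : ∀ l ∈ q, ∃ m ∈ l, GoodTable V m) : search c ρ loose strong ss q ≠ true := by
  classical
  intro h
  obtain ⟨q', ts, hq', hts, hp⟩ := search_spec h
  have hc10 := B.le
  have h0 : pairsWithin V 0 = ∅ :=
    Finset.filter_false_of_mem fun n hn => B.zero n (List.mem_toFinset.mp hn)
  refine pairSearch_eq_false B h10 hL ht c (j := 0) (by omega) (by omega) (by rw [h0]; simp; omega)
    ⟨fun n h => h, fun n hn => ?_, fun n hn h => ?_⟩ (fun n hn h => absurd h (B.zero n hn))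
    (fun n hn _ => ?_) (by simp) ((hts t).mpr htm) (fun l hl => ?_) (hp s hs)
  · exact ⟨fun h => absurd (List.mem_append_left _ hn) (not_mem_small h),
      fun h => absurd h (B.zero n hn)⟩
  · exact not_mem_small h (List.mem_append_right _ hn)
  · change ((0 >>> (5 * n)) &&& 31) = 0
    simp
  · obtain ⟨l', hl', hmem⟩ := hq' l hl
    obtain ⟨m, hm, hg⟩ := hq l' hl'
    exact ⟨m, (hmem m).mpr hm, hg⟩

end SetSearch

/-! ### Chains of quads -/

/-- A letter maps `X` onto `Y`. -/
def Transfers {Q : Type*} [DecidableEq Q] (R : ℕ → Finset Q → Prop) (X Y : Finset Q) : Prop :=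
  ∃ f : Q → Q, X.image f = Y ∧ ∀ Z ⊆ X, ∀ j, R j (Z.image f) → R (j + 1) Z

theorem Transfers.map_equiv {P Q : Type*} [DecidableEq P] [DecidableEq Q] {R : ℕ → Finset Q → Prop}
    (e : P ≃ Q) {X Y : Finset P} (h : Transfers R (X.map e.toEmbedding) (Y.map e.toEmbedding)) :
    Transfers (fun r (Z : Finset P) => R r (Z.map e.toEmbedding)) X Y := by
  obtain ⟨f, hf, hm⟩ := h
  have key : ∀ Z : Finset P, (Z.image fun x => e.symm (f (e x))).map e.toEmbedding =
      (Z.map e.toEmbedding).image f := by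
    intro Z
    simp [Finset.map_eq_image, Finset.image_image, Function.comp_def]
  refine ⟨fun x => e.symm (f (e x)), ?_, fun Z hZ j hj => ?_⟩
  · rw [← Finset.map_inj (f := e.toEmbedding), key, hf]
  · have hj' : R j _ := hj
    rw [key] at hj'
    exact hm _ (Finset.map_subset_map.mpr hZ) j hj'

/-- The preimages of two sets. -/
theorem Transfers.exists_preimages {Q : Type*} [DecidableEq Q] {R : ℕ → Finset Q → Prop}
    {X Y : Finset Q} (h : Transfers R X Y) (hc : Y.card = X.card) {U W : Finset Q} (hU : U ⊆ Y)
    (hW : W ⊆ Y) {j : ℕ} (hRU : R j U) (hRW : R j W) :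
    ∃ U' ⊆ X, ∃ W' ⊆ X, U'.card = U.card ∧ W'.card = W.card ∧ R (j + 1) U' ∧ R (j + 1) W' ∧
      (U ≠ W → U' ≠ W') := by
  obtain ⟨f, rfl, hm⟩ := h
  obtain ⟨U', hU', rfl, hcU⟩ := Finset.exists_subset_image_eq hc hU
  obtain ⟨W', hW', rfl, hcW⟩ := Finset.exists_subset_image_eq hc hW
  exact ⟨U', hU', W', hW', hcU, hcW, hm _ hU' j hRU, hm _ hW' j hRW, fun h h' => h (by rw [h'])⟩

/-- Follow the letters of a shortest word until the image first has fewer than four states. Every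
step lowers the level by exactly one. -/
theorem Layering.exists_quad_chain {Q : Type*} [DecidableEq Q] {R : ℕ → Finset Q → Prop}
    (hR : Layering R) {r : ℕ} {X : Finset Q} (h : AtLevel R r X) (hX : X.card = 4) :
    ∃ L < r, ∃ (s : ℕ → Finset Q) (T : Finset Q), AtLevel R L T ∧ T.card ≤ 3 ∧
      Transfers R (s (L + 1)) T ∧
      (∀ i, L < i → i ≤ r → AtLevel R i (s i) ∧ (s i).card = 4) ∧
      ∀ i, L < i → i < r → Transfers R (s (i + 1)) (s i) := by
  suffices ∃ L < r, ∃ (s : ℕ → Finset Q) (T : Finset Q), AtLevel R L T ∧ T.card ≤ 3 ∧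
      Transfers R (s (L + 1)) T ∧ s r = X ∧
      (∀ i, L < i → i ≤ r → AtLevel R i (s i) ∧ (s i).card = 4) ∧
      ∀ i, L < i → i < r → Transfers R (s (i + 1)) (s i) by
    obtain ⟨L, hL, s, T, h1, h2, h3, -, h4⟩ := this
    exact ⟨L, hL, s, T, h1, h2, h3, h4⟩
  induction r generalizing X with
  | zero =>
    have := (hR.zero_iff X).mp h.1
    omega
  | succ r ih =>
    obtain ⟨f, hf, hm⟩ := hR.exists_step h
    rcases Nat.lt_or_ge (X.image f).card 4 with hlt | hge
    · refine ⟨r, by omega, fun _ => X, _, hf, by omega, ⟨f, rfl, hm⟩, rfl, fun i hi hir => ?_,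
        fun i hi hir => by omega⟩
      obtain rfl : i = r + 1 := by omega
      exact ⟨h, hX⟩
    · have hle : (X.image f).card ≤ X.card := Finset.card_image_le
      obtain ⟨L, hL, s, T, h1, h2, h3, hs, h4, h5⟩ := ih hf (by omega)
      refine ⟨L, by omega, Function.update s (r + 1) X, T, h1, h2, ?_, by simp, fun i hi hir => ?_,
        fun i hi hir => ?_⟩
      · rwa [Function.update_of_ne (by omega)]
      · by_cases hir' : i = r + 1
        · subst hir'; simpa using ⟨h, hX⟩
        · rw [Function.update_of_ne hir']; exact h4 i hi (by omega)
      · rw [Function.update_of_ne (show i ≠ r + 1 by omega)]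
        by_cases hir' : i = r
        · subst hir'
          rw [Function.update_self, hs]
          exact ⟨f, rfl, hm⟩
        · rw [Function.update_of_ne (by omega)]
          exact h5 i hi (by omega)

/-! ### Coding sets of states and maps by numbers -/

namespace SetSearch

/-- The set with a given code. -/
def decode (n : ℕ) : Finset (Fin 5) := Finset.univ.filter fun i => n.testBit i = true

theorem mem_decode {n : ℕ} {i : Fin 5} : i ∈ decode n ↔ n.testBit i = true := by simp [decode]

theorem testBit_codeOf (l : List ℕ) (i : ℕ) : (codeOf l).testBit i = true ↔ i ∈ l := by
  induction l with
  | nil => simp [codeOf]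
  | cons a l ih =>
    have : codeOf (a :: l) = 2 ^ a ||| codeOf l := rfl
    rw [this, Nat.testBit_or, Nat.testBit_two_pow, Bool.or_eq_true, ih, decide_eq_true_eq,
      List.mem_cons, eq_comm]

theorem decode_codeOf (l : List (Fin 5)) : decode (codeOf (l.map Fin.val)) = l.toFinset := by
  ext i
  rw [mem_decode, testBit_codeOf, List.mem_toFinset, List.mem_map_of_injective Fin.val_injective]

theorem testBit_preimageCode (l : List (ℕ × ℕ)) (n i : ℕ) :
    (preimageCode l n).testBit i = true ↔ ∃ p ∈ l, p.1 = i ∧ n.testBit p.2 = true := by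
  induction l with
  | nil => simp [preimageCode]
  | cons a l ih =>
    have : preimageCode (a :: l) n =
      bif hasBit n a.2 then 2 ^ a.1 ||| preimageCode l n else preimageCode l n := rfl
    rw [this, hasBit_eq, List.exists_mem_cons_iff, ← ih]
    cases h : n.testBit a.2
    · simp
    · simp [Nat.testBit_two_pow]

theorem decode_preimageCode (l : List (Fin 5)) (f : Fin 5 → Fin 5) (n : ℕ) :
    decode (preimageCode ((l.map Fin.val).zip ((l.map f).map Fin.val)) n) =
      l.toFinset.filter fun i => f i ∈ decode n := by
  ext i
  rw [mem_decode, testBit_preimageCode, List.map_map, List.zip_map', Finset.mem_filter,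
    List.mem_toFinset, mem_decode]
  simp only [List.mem_map, Function.comp, exists_exists_and_eq_and]
  constructor
  · rintro ⟨a, ha, h1, h2⟩
    obtain rfl := Fin.ext h1
    exact ⟨ha, h2⟩
  · exact fun h => ⟨i, h.1, rfl, h.2⟩

theorem decode_classify : ∀ n < 32, ((decode n).card ≤ 1 → smallSets.testBit n = true) ∧
    ((decode n).card = 2 → n ∈ pairCodes) ∧ ((decode n).card = 3 → n ∈ tripleCodes) := by
  decide +kernel

theorem card_decode_of_pair : ∀ n ∈ pairCodes, (decode n).card = 2 := by decide +kernel

theorem card_decode_of_triple : ∀ n ∈ tripleCodes, (decode n).card = 3 := by decide +kernel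

theorem field_lt (m n : ℕ) : field m n < 32 := by
  have : field m n ≤ 31 := Nat.and_le_right
  omega

theorem mem_ontoTables {l : List ℕ} {a b c d : Fin 5} {tgt : ℕ}
    (h : codeOf [a.val, b.val, c.val, d.val] = tgt) :
    pack (l.zip [a.val, b.val, c.val, d.val]) ∈ ontoTables l tgt := by
  have hs : ∀ i : Fin 5, i.val ∈ states := by decide +kernel
  refine List.mem_map_of_mem (List.mem_filter.mpr ⟨?_, by simpa using h⟩)
  exact List.mem_flatMap.mpr ⟨a, hs a, List.mem_flatMap.mpr ⟨b, hs b, List.mem_flatMap.mpr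
    ⟨c, hs c, List.mem_map_of_mem (hs d)⟩⟩⟩

/-- The entries of the tables are the preimages. -/
def TableCorrect (l : List ℕ) (tgt : ℕ) : Prop :=
  ∀ a b c d : Fin 5, codeOf [a.val, b.val, c.val, d.val] = tgt → ∀ n ∈ pairCodes ++ tripleCodes,
    field (pack (l.zip [a.val, b.val, c.val, d.val])) n =
      preimageCode (l.zip [a.val, b.val, c.val, d.val]) n

theorem tableCorrect₁ : TableCorrect [0, 2, 3, 4] 30 := by
  unfold TableCorrect; decide +kernel

theorem tableCorrect₂ : TableCorrect [0, 1, 3, 4] 29 := by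
  unfold TableCorrect; decide +kernel

theorem tableCorrect₃ : TableCorrect [0, 1, 2, 4] 27 := by
  unfold TableCorrect; decide +kernel

theorem tableCorrect₄ : TableCorrect [0, 1, 2, 3] 23 := by
  unfold TableCorrect; decide +kernel

/-- A map of one quad onto another is injective on it, so preimages do not grow. They can shrink,
because a pair or triple may contain the state outside the target; hence the alternatives in
`GoodTable`. -/
theorem exists_goodTable {R : ℕ → Finset (Fin 5) → Prop} (hR : Layering R) (a b c d : Fin 5)
    (hl : [a, b, c, d].Nodup) {tgt : ℕ} (htgt : tgt < 32) (ht : (decode tgt).card = 4)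
    (hT : TableCorrect [a.val, b.val, c.val, d.val] tgt)
    (h : Transfers R {a, b, c, d} (decode tgt)) :
    ∃ m ∈ ontoTables [a.val, b.val, c.val, d.val] tgt, GoodTable (fun j n => R j (decode n)) m := by
  obtain ⟨f, hf, hm⟩ := h
  set X : Finset (Fin 5) := {a, b, c, d} with hX
  have hXl : X = [a, b, c, d].toFinset := by simp [hX]
  have hXc : X.card = 4 := by rw [hXl, List.toFinset_card_of_nodup hl]; rfl
  have hinj : (X.image f).card = X.card := by rw [hf, ht, hXc]
  have hcode : codeOf [(f a).val, (f b).val, (f c).val, (f d).val] = tgt := by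
    have h1 : decode (codeOf ([f a, f b, f c, f d].map Fin.val)) = decode tgt := by
      rw [decode_codeOf, ← hf, hX]
      simp [Finset.image_insert]
    have hlt : ∀ a b c d : Fin 5, codeOf [a.val, b.val, c.val, d.val] < 32 := by decide +kernel
    have hinj : ∀ m < 32, ∀ n < 32, decode m = decode n → m = n := by decide +kernel
    exact hinj _ (hlt _ _ _ _) _ htgt h1
  have hdec : ∀ n ∈ pairCodes ++ tripleCodes,
      decode (field (pack ([a.val, b.val, c.val, d.val].zip
        [(f a).val, (f b).val, (f c).val, (f d).val])) n) = X.filter fun i => f i ∈ decode n := by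
    intro n hn
    rw [hT _ _ _ _ hcode n hn, hXl]
    exact decode_preimageCode [a, b, c, d] f n
  have hcard : ∀ n, (X.filter fun i => f i ∈ decode n).card ≤ (decode n).card := by
    intro n
    refine Finset.card_le_card_of_injOn f (fun i hi => (Finset.mem_filter.mp hi).2) ?_
    exact (Finset.card_image_iff.mp hinj).mono (Finset.coe_subset.mpr (Finset.filter_subset _ _))
  have hback : ∀ n j, R j (decode n) → (X.filter fun i => f i ∈ decode n).Nonempty →
      R (j + 1) (X.filter fun i => f i ∈ decode n) := by
    intro n j hj hne
    refine hm _ (Finset.filter_subset _ _) j (hR.subset hj ?_ (hne.image f))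
    intro i hi
    obtain ⟨k, hk, rfl⟩ := Finset.mem_image.mp hi
    exact (Finset.mem_filter.mp hk).2
  refine ⟨_, mem_ontoTables hcode, ⟨fun n hn j hj => ?_, fun n hn j hj => ?_⟩⟩
  · have hc := hcard n
    have hb := hback n j hj
    rw [card_decode_of_pair n hn] at hc
    rw [← hdec n (List.mem_append_left _ hn)] at hc hb
    obtain ⟨h1, h2, -⟩ := decode_classify _ (field_lt (pack ([a.val, b.val, c.val, d.val].zip
        [(f a).val, (f b).val, (f c).val, (f d).val])) n)
    rcases Nat.lt_or_ge 1 (decode (field (pack ([a.val, b.val, c.val, d.val].zip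
        [(f a).val, (f b).val, (f c).val, (f d).val])) n)).card with h | h
    · exact .inr ⟨h2 (by omega), hb (Finset.card_pos.mp (by omega))⟩
    · exact .inl (h1 h)
  · have hc := hcard n
    have hb := hback n j hj
    rw [card_decode_of_triple n hn] at hc
    rw [← hdec n (List.mem_append_right _ hn)] at hc hb
    obtain ⟨h1, h2, h3⟩ := decode_classify _ (field_lt (pack ([a.val, b.val, c.val, d.val].zip
        [(f a).val, (f b).val, (f c).val, (f d).val])) n)
    generalize decode (field (pack ([a.val, b.val, c.val, d.val].zip
        [(f a).val, (f b).val, (f c).val, (f d).val])) n) = Z at *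
    rcases (show Z.card ≤ 1 ∨ Z.card = 2 ∨ Z.card = 3 by omega) with h | h | h
    · exact .inl (h1 h)
    · exact .inr (.inl (h2 h))
    · exact .inr (.inr ⟨h3 h, hb (Finset.card_pos.mp (by omega))⟩)

end SetSearch

/-! ### From a chain of quads to the hypotheses of the search -/

namespace SetSearch

theorem mem_pairCodes_of_ne : ∀ a b : Fin 5, a ≠ b → codeOf [a.val, b.val] ∈ pairCodes := by
  decide +kernel

theorem exists_triangle (a b c : Fin 5) (hab : a ≠ b) (hac : a ≠ c) (hbc : b ≠ c) :
    ∃ y ∈ triangles, y.code = codeOf [a.val, b.val, c.val] ∧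
      ((y.edge₁ = codeOf [a.val, b.val] ∧ y.edge₂ = codeOf [a.val, c.val] ∧
          y.edge₃ = codeOf [b.val, c.val]) ∨
        (y.edge₁ = codeOf [a.val, b.val] ∧ y.edge₃ = codeOf [a.val, c.val] ∧
          y.edge₂ = codeOf [b.val, c.val]) ∨
        (y.edge₂ = codeOf [a.val, b.val] ∧ y.edge₁ = codeOf [a.val, c.val] ∧
          y.edge₃ = codeOf [b.val, c.val]) ∨
        (y.edge₂ = codeOf [a.val, b.val] ∧ y.edge₃ = codeOf [a.val, c.val] ∧
          y.edge₁ = codeOf [b.val, c.val]) ∨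
        (y.edge₃ = codeOf [a.val, b.val] ∧ y.edge₁ = codeOf [a.val, c.val] ∧
          y.edge₂ = codeOf [b.val, c.val]) ∨
        (y.edge₃ = codeOf [a.val, b.val] ∧ y.edge₂ = codeOf [a.val, c.val] ∧
          y.edge₁ = codeOf [b.val, c.val])) := by
  revert a b c
  decide +kernel

theorem triangle_vertices : ∀ t ∈ triangles, ∃ a b c : Fin 5, a ≠ b ∧ a ≠ c ∧ b ≠ c ∧
    t.code = codeOf [a.val, b.val, c.val] ∧ t.edge₁ = codeOf [a.val, b.val] ∧
    t.edge₂ = codeOf [a.val, c.val] ∧ t.edge₃ = codeOf [b.val, c.val] := by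
  decide +kernel

theorem decode_pair (a b : Fin 5) : decode (codeOf [a.val, b.val]) = {a, b} := by
  simpa using decode_codeOf [a, b]

theorem decode_triple (a b c : Fin 5) : decode (codeOf [a.val, b.val, c.val]) = {a, b, c} := by
  simpa using decode_codeOf [a, b, c]

theorem exists_mem_pairCodes (Z : Finset (Fin 5)) (h : Z.card = 2) :
    ∃ n ∈ pairCodes, decode n = Z := by
  obtain ⟨a, b, hab, rfl⟩ := Finset.card_eq_two.mp h
  exact ⟨_, mem_pairCodes_of_ne a b hab, decode_pair a b⟩

theorem exists_mem_triangles (Z : Finset (Fin 5)) (h : Z.card = 3) :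
    ∃ t ∈ triangles, decode t.code = Z := by
  obtain ⟨a, b, c, hab, hac, hbc, rfl⟩ := Finset.card_eq_three.mp h
  obtain ⟨t, ht, hc, -⟩ := exists_triangle a b c hab hac hbc
  exact ⟨t, ht, by rw [hc, decode_triple]⟩

theorem mem_mergeImages (P X Y : Fin 5) (hPX : P ≠ X) (hPY : P ≠ Y) (hXY : X ≠ Y) :
    (⟨codeOf [P.val, X.val], codeOf [P.val, Y.val], codeOf [X.val, Y.val],
      codeOf [P.val, X.val, Y.val]⟩ : MergeImage) ∈ mergeImages := by
  have hs : ∀ i : Fin 5, i.val ∈ states := by decide +kernel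
  have hne : ∀ {a b : Fin 5}, a ≠ b → Nat.beq a b = false := fun h => by
    simpa [Fin.ext_iff, ← Bool.not_eq_true] using h
  refine List.mem_flatMap.mpr ⟨P, hs P, List.mem_flatMap.mpr ⟨X, hs X, List.mem_flatMap.mpr
    ⟨Y, hs Y, ?_⟩⟩⟩
  rw [hne hPX, hne hPY, hne hXY]
  exact List.mem_singleton.mpr rfl

/-- Quads `univ.erase i` on consecutive levels above the triple `{f p, f x, f y}` on level `L`. -/
structure QuadChain (R : ℕ → Finset (Fin 5) → Prop) (c L : ℕ) (f : Fin 5 → Fin 5)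
    (p q x y : Fin 5) : Prop where
  layering : Layering R
  step : ∀ Z ⊆ Finset.univ.erase 0, ∀ j, R j (Z.image f) → R (j + 1) Z
  eq : f p = f q
  quad : ({p, q, x, y} : Finset (Fin 5)) = Finset.univ.erase 0
  ne : p ≠ q ∧ p ≠ x ∧ p ≠ y ∧ q ≠ x ∧ q ≠ y ∧ x ≠ y
  image_ne : f p ≠ f x ∧ f p ≠ f y ∧ f x ≠ f y
  level : AtLevel R L {f p, f x, f y}
  back : ∀ i j : Fin 5, j.val = i.val + 1 → L + 1 + j.val ≤ 23 →
    Transfers R (Finset.univ.erase j) (Finset.univ.erase i)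
  pairs : ∀ Z : Finset (Fin 5), Z.card = 2 → R c Z
  pair_new : ∀ j < c, ∃ Z : Finset (Fin 5), Z.card = 2 ∧ R (j + 1) Z ∧ ¬ R j Z
  le : c ≤ 10

namespace QuadChain

variable {R : ℕ → Finset (Fin 5) → Prop} {c L ρ : ℕ} {f : Fin 5 → Fin 5} {p q x y : Fin 5}
  (C : QuadChain R c L f p q x y)
include C

theorem subset_pqx : ({p, q, x} : Finset (Fin 5)) ⊆ Finset.univ.erase 0 := by
  rw [← C.quad]; intro i; simp; tauto

theorem subset_pqy : ({p, q, y} : Finset (Fin 5)) ⊆ Finset.univ.erase 0 := by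
  rw [← C.quad]; intro i; simp; tauto

theorem card_pqx : ({p, q, x} : Finset (Fin 5)).card = 3 :=
  Finset.card_eq_three.mpr ⟨p, q, x, C.ne.1, C.ne.2.1, C.ne.2.2.2.1, rfl⟩

theorem card_pqy : ({p, q, y} : Finset (Fin 5)).card = 3 :=
  Finset.card_eq_three.mpr ⟨p, q, y, C.ne.1, C.ne.2.2.1, C.ne.2.2.2.2.1, rfl⟩

theorem pqx_ne_pqy : ({p, q, x} : Finset (Fin 5)) ≠ {p, q, y} := by
  intro h
  have : x ∈ ({p, q, y} : Finset (Fin 5)) := h ▸ by simp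
  simp only [Finset.mem_insert, Finset.mem_singleton] at this
  have := C.ne
  grind

theorem lift_pqx {j : ℕ} (h : R j {f p, f x}) : R (j + 1) {p, q, x} :=
  C.step _ C.subset_pqx j (by simpa [Finset.image_insert, ← C.eq] using h)

theorem lift_pqy {j : ℕ} (h : R j {f p, f y}) : R (j + 1) {p, q, y} :=
  C.step _ C.subset_pqy j (by simpa [Finset.image_insert, ← C.eq] using h)

theorem card_image : ({f p, f x, f y} : Finset (Fin 5)).card = 3 :=
  Finset.card_eq_three.mpr ⟨_, _, _, C.image_ne.1, C.image_ne.2.1, C.image_ne.2.2, rfl⟩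

/-- Above the level of the pairs, there are only triples. -/
theorem card_eq_three {j : ℕ} (hj : c < j) {Z : Finset (Fin 5)} (hZ : AtLevel R j Z)
    (h3 : Z.card ≤ 3) : Z.card = 3 := by
  have h2 := C.layering.two_le_card hZ (by omega)
  by_contra hne
  have := C.layering.atLevel_le hZ (C.pairs Z (by omega))
  omega

/-- The triples in `G` are used up by level `j`, and each level from j + 1 to `L` needs another one
of the ten triples. -/
theorem card_add_le {j : ℕ} (hc : c ≤ j) (hj : j ≤ L) (G : Finset (Finset (Fin 5)))
    (hG : ∀ Z ∈ G, Z.card = 3 ∧ R j Z) : G.card + (L - j) ≤ 10 := by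
  have h1 := C.layering.sub_le_card (i := j) C.level (Finset.powersetCard 3 Finset.univ \ G) (by
    intro Y i hji _ hY hYc
    rw [C.card_image] at hYc
    refine Finset.mem_sdiff.mpr ⟨?_, fun h => ?_⟩
    · simpa using C.card_eq_three (by omega) hY hYc
    · have := C.layering.atLevel_le hY (hG Y h).2
      omega)
  have hsub : G ⊆ Finset.powersetCard 3 Finset.univ := fun Z hZ => by simpa using (hG Z hZ).1
  have h2 := Finset.card_le_card hsub
  rw [Finset.card_sdiff_of_subset hsub] at h1
  have h3 : (Finset.powersetCard 3 (Finset.univ : Finset (Fin 5))).card = 10 := by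
    rw [Finset.card_powersetCard]; rfl
  omega

/-- If there is no room for a third triple, then the low triples are the only ones. -/
theorem eq_or_eq {j : ℕ} (hc : c ≤ j) (hj : j + 8 = L) (hx : R j {p, q, x}) (hy : R j {p, q, y})
    {Z : Finset (Fin 5)} (hZ : Z.card = 3) (hRZ : R j Z) : Z = {p, q, x} ∨ Z = {p, q, y} := by
  by_contra! hne
  have := C.card_add_le hc (by omega) {Z, {p, q, x}, {p, q, y}} (by
    intro W hW
    simp only [Finset.mem_insert, Finset.mem_singleton] at hW
    rcases hW with rfl | rfl | rfl
    exacts [⟨hZ, hRZ⟩, ⟨C.card_pqx, hx⟩, ⟨C.card_pqy, hy⟩])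
  rw [Finset.card_eq_three.mpr ⟨_, _, _, hne.1, hne.2, C.pqx_ne_pqy, rfl⟩] at this
  omega

theorem not_low {j : ℕ} (hc : c ≤ j) (hj : j + 9 = L) (hx : R j {p, q, x}) (hy : R j {p, q, y}) :
    False := by
  have := C.card_add_le hc (by omega) {{p, q, x}, {p, q, y}} (by
    intro W hW
    simp only [Finset.mem_insert, Finset.mem_singleton] at hW
    rcases hW with rfl | rfl
    exacts [⟨C.card_pqx, hx⟩, ⟨C.card_pqy, hy⟩])
  rw [Finset.card_pair C.pqx_ne_pqy] at this
  omega

theorem preimages {i j : Fin 5} (hij : j.val = i.val + 1) (hj : L + 1 + j.val ≤ 23)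
    {U W : Finset (Fin 5)} (hU : i ∉ U) (hW : i ∉ W) {r : ℕ} (hRU : R r U) (hRW : R r W) :
    ∃ U' W' : Finset (Fin 5), j ∉ U' ∧ j ∉ W' ∧ U'.card = U.card ∧ W'.card = W.card ∧
      R (r + 1) U' ∧ R (r + 1) W' ∧ (U ≠ W → U' ≠ W') := by
  have hsub : ∀ {k : Fin 5} {Z : Finset (Fin 5)}, k ∉ Z ↔ Z ⊆ Finset.univ.erase k := by
    intro k Z
    rw [Finset.subset_erase]
    simp
  obtain ⟨U', hU', W', hW', h⟩ := (C.back i j hij hj).exists_preimages (by simp)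
    (hsub.mp hU) (hsub.mp hW) hRU hRW
  exact ⟨U', W', hsub.mpr hU', hsub.mpr hW', h⟩

theorem zero_notMem : 0 ∉ ({p, q, x} : Finset (Fin 5)) ∧ 0 ∉ ({p, q, y} : Finset (Fin 5)) :=
  ⟨fun h => by simpa using C.subset_pqx h, fun h => by simpa using C.subset_pqy h⟩

/-- The preimages of the low triples in the quad omitting 1 are within ρ + 1, where there is room
for only three triples. So one of the preimages is a low triple itself; it contains p and q, and it
omits 1. -/
theorem one_ne_merged (hc : c ≤ ρ) (hL : ρ + 8 = L) (hL' : L ≤ 21) (hx : R ρ {p, q, x})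
    (hy : R ρ {p, q, y}) : p ≠ 1 ∧ q ≠ 1 := by
  obtain ⟨U, W, hU, hW, hcU, hcW, hRU, hRW, hne⟩ := C.preimages (i := 0) (j := 1) rfl
    (by simp; omega) C.zero_notMem.1 C.zero_notMem.2 hx hy
  rw [C.card_pqx] at hcU
  rw [C.card_pqy] at hcW
  have key : ∀ Z : Finset (Fin 5), (Z = {p, q, x} ∨ Z = {p, q, y}) → 1 ∉ Z → p ≠ 1 ∧ q ≠ 1 := by
    rintro Z (rfl | rfl) h <;> simp only [Finset.mem_insert, not_or] at h <;>
      exact ⟨Ne.symm h.1, Ne.symm h.2.1⟩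
  by_cases hU1 : U = {p, q, x} ∨ U = {p, q, y}
  · exact key U hU1 hU
  by_cases hW1 : W = {p, q, x} ∨ W = {p, q, y}
  · exact key W hW1 hW
  exfalso
  push Not at hU1 hW1
  have := C.card_add_le (j := ρ + 1) (by omega) (by omega) {U, W, {p, q, x}, {p, q, y}} (by
    intro Z hZ
    simp only [Finset.mem_insert, Finset.mem_singleton] at hZ
    rcases hZ with rfl | rfl | rfl | rfl
    exacts [⟨hcU, hRU⟩, ⟨hcW, hRW⟩, ⟨C.card_pqx, C.layering.succ hx⟩,
      ⟨C.card_pqy, C.layering.succ hy⟩])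
  rw [Finset.card_insert_of_notMem (by
      simp only [Finset.mem_insert, Finset.mem_singleton, not_or]
      exact ⟨hne C.pqx_ne_pqy, hU1.1, hU1.2⟩),
    Finset.card_eq_three.mpr ⟨_, _, _, hW1.1, hW1.2, C.pqx_ne_pqy, rfl⟩] at this
  omega

/-- The low triples cannot be much lower than the pairs. -/
theorem not_low_of_eq (hL : c + 8 = L) (hL' : L ≤ 21) (hx : R (c - 1) {p, q, x})
    (hy : R (c - 1) {p, q, y}) (hc : 1 ≤ c) : False := by
  obtain ⟨U, W, hU, hW, hcU, hcW, hRU, hRW, hne⟩ := C.preimages (i := 0) (j := 1) rfl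
    (by simp; omega) C.zero_notMem.1 C.zero_notMem.2 hx hy
  rw [C.card_pqx] at hcU
  rw [C.card_pqy] at hcW
  rw [Nat.sub_add_cancel hc] at hRU hRW
  have hx' := C.layering.mono (Nat.sub_le c 1) hx
  have hy' := C.layering.mono (Nat.sub_le c 1) hy
  -- There is no room for a third triple within `c`, so the two distinct preimages are the low
  -- triples themselves. Both then omit 1, which contradicts 1 ∈ {p,q,x,y}.
  have hUe := C.eq_or_eq le_rfl hL hx' hy' hcU hRU
  have hWe := C.eq_or_eq le_rfl hL hx' hy' hcW hRW
  have hUW := hne C.pqx_ne_pqy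
  have h1 : (1 : Fin 5) ∈ ({p, q, x, y} : Finset (Fin 5)) := by rw [C.quad]; decide
  simp only [Finset.mem_insert, Finset.mem_singleton] at h1
  have hx1 : (1 : Fin 5) ∉ ({p, q, x} : Finset (Fin 5)) := by
    rcases hUe with rfl | rfl
    · exact hU
    · rcases hWe with rfl | rfl
      exacts [hW, absurd rfl hUW]
  have hy1 : (1 : Fin 5) ∉ ({p, q, y} : Finset (Fin 5)) := by
    rcases hUe with rfl | rfl
    · rcases hWe with rfl | rfl
      exacts [absurd rfl hUW, hW]
    · exact hU
  simp only [Finset.mem_insert, Finset.mem_singleton] at hx1 hy1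
  tauto

/-- If only one triple can be on the low levels, then this triple avoids three states. -/
theorem not_low_seven (hc : c = 9) (hL : L = 18) {U : Finset (Fin 5)} (hU : U.card = 3) (h0 : 0 ∉ U)
    (h7 : R 7 U) : False := by
  have huniq : ∀ W : Finset (Fin 5), W.card = 3 → R 9 W → W = U := by
    intro W hW hRW
    by_contra hne
    have := C.card_add_le (j := 9) (by omega) (by omega) {W, U} (by
      intro Z hZ
      simp only [Finset.mem_insert, Finset.mem_singleton] at hZ
      rcases hZ with rfl | rfl
      exacts [⟨hW, hRW⟩, ⟨hU, C.layering.mono (by omega) h7⟩])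
    rw [Finset.card_pair hne] at this
    omega
  -- A preimage of `U` in the next quad is within level 8, so it is `U` again by uniqueness; hence
  -- `U` omits the next state as well.
  have next : ∀ i j : Fin 5, j.val = i.val + 1 → i ∉ U → j ∉ U := by
    intro i j hij hi
    obtain ⟨W, -, hW, -, hcW, -, hRW, -, -⟩ := C.preimages hij (by omega) hi hi h7 h7
    exact huniq W (hcW.trans hU) (C.layering.succ hRW) ▸ hW
  have h1 := next 0 1 rfl h0
  have h2 := next 1 2 rfl h1
  have : U ⊆ {3, 4} := by
    intro i hi
    fin_cases i
    exacts [absurd hi h0, absurd hi h1, absurd hi h2, by simp, by simp]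
  have := Finset.card_le_card this
  simp [hU] at this

theorem branch (hρ : c ≤ ρ) (hx : R ρ {p, q, x}) (hy : R ρ {p, q, y}) :
    Branch (fun j n => R j (decode n)) c ρ L (mergeSource p q x y) where
  succ _ _ h := C.layering.succ h
  zero n hn h := by
    rw [C.layering.zero_iff, card_decode_of_pair n hn] at h
    omega
  mem := by
    obtain ⟨h1, h2, h3, h4, h5, h6⟩ := C.ne
    exact ⟨mem_pairCodes_of_ne _ _ h1, mem_pairCodes_of_ne _ _ h2, mem_pairCodes_of_ne _ _ h4,
      mem_pairCodes_of_ne _ _ h3, mem_pairCodes_of_ne _ _ h5, mem_pairCodes_of_ne _ _ h6⟩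
  low_mem := by
    obtain ⟨h1, h2, h3, h4, h5, h6⟩ := C.ne
    obtain ⟨t, ht, htc, -⟩ := exists_triangle p q x h1 h2 h4
    obtain ⟨u, hu, huc, -⟩ := exists_triangle p q y h1 h3 h5
    refine ⟨t, ht, u, hu, htc, huc, fun h => C.pqx_ne_pqy ?_⟩
    rw [← decode_triple p q x, ← decode_triple p q y, ← htc, ← huc, h]
  merged := by
    rw [show (mergeSource p q x y).pq = codeOf [p.val, q.val] from rfl, decode_pair]
    refine C.step _ (fun i hi => C.subset_pqx ?_) 0 ?_
    · simp only [Finset.mem_insert, Finset.mem_singleton] at hi ⊢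
      tauto
    · rw [C.layering.zero_iff]
      simp [Finset.image_insert, ← C.eq]
  pairs n hn := C.pairs _ (card_decode_of_pair n hn)
  pair_new j hj := by
    obtain ⟨Z, hZ, h1, h0⟩ := C.pair_new j hj
    obtain ⟨n, hn, rfl⟩ := exists_mem_pairCodes Z hZ
    exact ⟨n, hn, h1, h0⟩
  le := C.le
  low := by
    change R ρ (decode (codeOf [p.val, q.val, x.val])) ∧ R ρ (decode (codeOf [p.val, q.val, y.val]))
    rw [decode_triple, decode_triple]
    exact ⟨hx, hy⟩
  triple_new j hj hjL := by
    obtain ⟨Z, hZ, hc⟩ := C.layering.exists_atLevel_of_le C.level (show j + 1 ≤ L by omega)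
    rw [C.card_image] at hc
    obtain ⟨t, ht, rfl⟩ := exists_mem_triangles Z (C.card_eq_three (by omega) hZ hc)
    exact ⟨t, ht, hZ.1, hZ.2 j (by omega)⟩
  step j hj hjL t ht h1 h0 := by
    have hcle := C.le
    obtain ⟨g, hg, hm⟩ := C.layering.exists_step (C.layering.atLevel_of_not h1 h0)
    obtain ⟨a, b, d, hab, had, hbd, htc, ht1, ht2, ht3⟩ := triangle_vertices t ht
    rw [htc, decode_triple] at hg hm
    have himg : ({a, b, d} : Finset (Fin 5)).image g = {g a, g b, g d} := by
      simp [Finset.image_insert]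
    have hc3 : ({a, b, d} : Finset (Fin 5)).card = 3 :=
      Finset.card_eq_three.mpr ⟨_, _, _, hab, had, hbd, rfl⟩
    -- Pairs do not occur above level `c`, so the image is a triple again and `g` is injective on
    -- the given one.
    have hcard := C.card_eq_three (by omega) hg (Finset.card_image_le.trans hc3.le)
    have hinj : Set.InjOn g ({a, b, d} : Finset (Fin 5)) :=
      Finset.card_image_iff.mp (hcard.trans hc3.symm)
    obtain ⟨y, hy, hyc, hye⟩ := exists_triangle (g a) (g b) (g d)
      (fun h => hab (hinj (by simp) (by simp) h)) (fun h => had (hinj (by simp) (by simp) h))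
      (fun h => hbd (hinj (by simp) (by simp) h))
    rw [himg, ← decode_triple, ← hyc] at hg
    refine ⟨y, hy, hg.1, hg.2 (j - 1) (by omega), ?_⟩
    have key : Follows (fun j n => R j (decode n)) t (codeOf [(g a).val, (g b).val])
        (codeOf [(g a).val, (g d).val]) (codeOf [(g b).val, (g d).val]) := by
      intro i
      simp only [decode_pair, ht1, ht2, ht3]
      refine ⟨fun h => hm _ (by simp) i ?_,
        fun h => hm _ (by simp [Finset.insert_subset_iff]) i ?_,
        fun h => hm _ (by simp) i ?_⟩ <;>
      simpa [Finset.image_insert] using h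
    rcases hye with h | h | h | h | h | h
    · exact .inl (by rw [h.1, h.2.1, h.2.2]; exact key)
    · exact .inr (.inl (by rw [h.1, h.2.1, h.2.2]; exact key))
    · exact .inr (.inr (.inl (by rw [h.1, h.2.1, h.2.2]; exact key)))
    · exact .inr (.inr (.inr (.inl (by rw [h.1, h.2.1, h.2.2]; exact key))))
    · exact .inr (.inr (.inr (.inr (.inl (by rw [h.1, h.2.1, h.2.2]; exact key)))))
    · exact .inr (.inr (.inr (.inr (.inr (by rw [h.1, h.2.1, h.2.2]; exact key)))))

theorem goodImage {strong : Bool} (hL : 1 ≤ L) (hstrong : strong = true → c = 9 ∧ L = 18)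
    (hbase : ¬ (R (ρ - 2) {f p, f x} ∧ R (ρ - 2) {f p, f y})) :
    GoodImage (fun j n => R j (decode n)) ρ L strong (mergeSource p q x y)
      ⟨codeOf [(f p).val, (f x).val], codeOf [(f p).val, (f y).val],
        codeOf [(f x).val, (f y).val], codeOf [(f p).val, (f x).val, (f y).val]⟩ where
  PX_mem := mem_pairCodes_of_ne _ _ C.image_ne.1
  PY_mem := mem_pairCodes_of_ne _ _ C.image_ne.2.1
  PX j h := by
    simp only [decode_pair] at h
    have hx := C.lift_pqx h
    simp only [mergeSource, decode_pair]
    refine ⟨C.layering.subset hx ?_ (by simp), C.layering.subset hx ?_ (by simp)⟩ <;>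
      (intro k hk; simp only [Finset.mem_insert, Finset.mem_singleton] at hk ⊢; tauto)
  PY j h := by
    simp only [decode_pair] at h
    have hy := C.lift_pqy h
    simp only [mergeSource, decode_pair]
    refine ⟨C.layering.subset hy ?_ (by simp), C.layering.subset hy ?_ (by simp)⟩ <;>
      (intro k hk; simp only [Finset.mem_insert, Finset.mem_singleton] at hk ⊢; tauto)
  XY j h := by
    simp only [decode_pair] at h
    simp only [mergeSource, decode_pair]
    refine C.step _ ?_ j (by simpa [Finset.image_insert] using h)
    rw [← C.quad]
    intro k hk
    simp only [Finset.mem_insert, Finset.mem_singleton] at hk ⊢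
    tauto
  PXY := by
    obtain ⟨t, ht, htc, -⟩ := exists_triangle _ _ _ C.image_ne.1 C.image_ne.2.1 C.image_ne.2.2
    refine ⟨t, ht, htc, ?_⟩
    rw [htc, decode_triple]
    exact ⟨C.level.1, C.level.2 _ (by omega)⟩
  strong hs := by
    obtain ⟨hc, hL⟩ := hstrong hs
    simp only [decode_pair]
    exact ⟨fun h => C.not_low_seven hc hL C.card_pqx C.zero_notMem.1 (C.lift_pqx h),
      fun h => C.not_low_seven hc hL C.card_pqy C.zero_notMem.2 (C.lift_pqy h)⟩
  base := by simpa only [decode_pair] using hbase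

/-- The quad omitting 4 would be on level L + 5, so it is available only for L ≤ 18. -/
theorem goodTables {q' : List (List ℕ)} (h : (L ≤ 19 ∧ q' = fourTables) ∨ (L ≤ 18 ∧ q' = fiveTables)) :
    ∀ l ∈ q', ∃ m ∈ l, GoodTable (fun j n => R j (decode n)) m := by
  have four : L ≤ 19 → ∀ l ∈ fourTables, ∃ m ∈ l, GoodTable (fun j n => R j (decode n)) m := by
    intro hL l hl
    simp only [fourTables, List.mem_cons, List.not_mem_nil, or_false] at hl
    rcases hl with rfl | rfl | rfl
    · refine exists_goodTable C.layering 0 2 3 4 (by decide) (by decide) (by decide +kernel)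
        tableCorrect₁ ?_
      convert C.back 0 1 rfl (by simp; omega) using 1 <;> decide +kernel
    · refine exists_goodTable C.layering 0 1 3 4 (by decide) (by decide) (by decide +kernel)
        tableCorrect₂ ?_
      convert C.back 1 2 rfl (by simp; omega) using 1 <;> decide +kernel
    · refine exists_goodTable C.layering 0 1 2 4 (by decide) (by decide) (by decide +kernel)
        tableCorrect₃ ?_
      convert C.back 2 3 rfl (by simp; omega) using 1 <;> decide +kernel
  rcases h with ⟨hL, rfl⟩ | ⟨hL, rfl⟩
  · exact four hL
  · intro l hl
    rcases List.mem_cons.mp hl with rfl | hl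
    · refine exists_goodTable C.layering 0 1 2 3 (by decide) (by decide) (by decide +kernel)
        tableCorrect₄ ?_
      convert C.back 3 4 rfl (by simp; omega) using 1 <;> decide +kernel
    · exact four (by omega) l hl

end QuadChain

end SetSearch

/-! ### Evaluation of the four searches -/

namespace SetSearch
-- L = 19 and c = 10: four quads, and no surplus among pairs or triples.
theorem search_four_tight : search 10 11 false false tightSources fourTables = true := by
  decide +kernel

/-- L = 18 and c = 9: two pairs share a level, and the triples are tight. -/
theorem search_five_ties : search 9 10 false true tightSources fiveTables = true := by
  decide +kernel

/-- L = 18 and c = 10, with both low triples within level 10, so that the triples are tight. -/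
theorem search_five_tight : search 10 10 false false tightSources fiveTables = true := by
  decide +kernel

/-- L = 18 and c = 10, with a low triple above level 10. One triple is spare, so state 1 may be
among the merged ones and all six merges are needed. -/
theorem search_five_loose : search 10 11 true false allSources fiveTables = true := by
  decide +kernel

end SetSearch

/-! ### Excluding chains of quads up to level 23 -/

namespace SetSearch

/-- Up to order, two states of a quad can be merged in six ways. -/
theorem exists_merge_order : ∀ p q : Fin 5, p ≠ 0 → q ≠ 0 → p ≠ q →
    ∃ v ∈ ([(1, 2, 3, 4), (1, 3, 2, 4), (1, 4, 2, 3), (2, 3, 1, 4), (2, 4, 1, 3), (3, 4, 1, 2)] :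
        List (Fin 5 × Fin 5 × Fin 5 × Fin 5)), v.1 = p ∧ v.2.1 = q ∨ v.1 = q ∧ v.2.1 = p := by
  decide +kernel

theorem merge_order_ne : ∀ v ∈ ([(1, 2, 3, 4), (1, 3, 2, 4), (1, 4, 2, 3), (2, 3, 1, 4), (2, 4, 1, 3),
        (3, 4, 1, 2)] : List (Fin 5 × Fin 5 × Fin 5 × Fin 5)),
      v.1 ≠ v.2.1 ∧ v.1 ≠ v.2.2.1 ∧ v.1 ≠ v.2.2.2 ∧ v.2.1 ≠ v.2.2.1 ∧ v.2.1 ≠ v.2.2.2 ∧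
        v.2.2.1 ≠ v.2.2.2 := by
  decide +kernel

theorem merge_order_eq : ∀ v ∈ ([(1, 2, 3, 4), (1, 3, 2, 4), (1, 4, 2, 3), (2, 3, 1, 4), (2, 4, 1, 3),
        (3, 4, 1, 2)] : List (Fin 5 × Fin 5 × Fin 5 × Fin 5)),
      ({v.1, v.2.1, v.2.2.1, v.2.2.2} : Finset (Fin 5)) = Finset.univ.erase 0 := by
  decide +kernel

theorem merge_order_tight : ∀ v ∈ ([(1, 2, 3, 4), (1, 3, 2, 4), (1, 4, 2, 3), (2, 3, 1, 4),
        (2, 4, 1, 3), (3, 4, 1, 2)] : List (Fin 5 × Fin 5 × Fin 5 × Fin 5)),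
      v.1 ≠ 1 ∧ v.2.1 ≠ 1 → v ∈ ([(2, 3, 1, 4), (2, 4, 1, 3), (3, 4, 1, 2)] :
        List (Fin 5 × Fin 5 × Fin 5 × Fin 5)) := by
  decide +kernel

theorem mem_allSources (v : Fin 5 × Fin 5 × Fin 5 × Fin 5)
    (h : v ∈ ([(1, 2, 3, 4), (1, 3, 2, 4), (1, 4, 2, 3), (2, 3, 1, 4), (2, 4, 1, 3), (3, 4, 1, 2)] :
        List (Fin 5 × Fin 5 × Fin 5 × Fin 5))) :
    mergeSource v.1 v.2.1 v.2.2.1 v.2.2.2 ∈ allSources :=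
  List.mem_map_of_mem (f := fun v : Fin 5 × Fin 5 × Fin 5 × Fin 5 =>
    mergeSource v.1 v.2.1 v.2.2.1 v.2.2.2) h

theorem mem_tightSources (v : Fin 5 × Fin 5 × Fin 5 × Fin 5)
    (h : v ∈ ([(2, 3, 1, 4), (2, 4, 1, 3), (3, 4, 1, 2)] :
        List (Fin 5 × Fin 5 × Fin 5 × Fin 5))) :
    mergeSource v.1 v.2.1 v.2.2.1 v.2.2.2 ∈ tightSources :=
  List.mem_map_of_mem (f := fun v : Fin 5 × Fin 5 × Fin 5 × Fin 5 =>
    mergeSource v.1 v.2.1 v.2.2.1 v.2.2.2) h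

namespace QuadChain

variable {R : ℕ → Finset (Fin 5) → Prop} {c L : ℕ} {f : Fin 5 → Fin 5} {p q x y : Fin 5}

theorem elim (C : QuadChain R c L f p q x y) (h18 : 18 ≤ L) (hall : mergeSource p q x y ∈ allSources)
    (htight : p ≠ 1 ∧ q ≠ 1 → mergeSource p q x y ∈ tightSources) : False := by
  have hx : R (c + 1) {p, q, x} := C.lift_pqx (C.pairs _ (Finset.card_pair C.image_ne.1))
  have hy : R (c + 1) {p, q, y} := C.lift_pqy (C.pairs _ (Finset.card_pair C.image_ne.2.1))
  have hc := C.le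
  have hcount := C.card_add_le (j := c + 1) (by omega) (by omega) {{p, q, x}, {p, q, y}} (by
    intro W hW
    simp only [Finset.mem_insert, Finset.mem_singleton] at hW
    rcases hW with rfl | rfl
    exacts [⟨C.card_pqx, hx⟩, ⟨C.card_pqy, hy⟩])
  rw [Finset.card_pair C.pqx_ne_pqy] at hcount
  have himg := mem_mergeImages _ _ _ C.image_ne.1 C.image_ne.2.1 C.image_ne.2.2
  have lift : ∀ {r : ℕ}, 2 ≤ r → R (r - 2) {f p, f x} ∧ R (r - 2) {f p, f y} →
      R (r - 1) {p, q, x} ∧ R (r - 1) {p, q, y} := by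
    intro r hr h
    rw [show r - 1 = r - 2 + 1 by omega]
    exact ⟨C.lift_pqx h.1, C.lift_pqy h.2⟩
  -- The low triples are within c + 1, so 2 + (L - c - 1) ≤ 10, that is, L ≤ c + 9.
  rcases (show L = 19 ∧ c = 10 ∨ L = 18 ∧ c = 9 ∨ L = 18 ∧ c = 10 by omega) with
    ⟨rfl, rfl⟩ | ⟨rfl, rfl⟩ | ⟨rfl, rfl⟩
  · refine search_ne_true (ρ := 11) (C.branch (by omega) hx hy) (by omega) (by omega) rfl
      (C.goodImage (strong := false) (by omega) (by simp) fun h => ?_) himg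
      (htight (C.one_ne_merged (ρ := 11) (by omega) (by omega) (by omega) hx hy))
      (C.goodTables (.inl ⟨le_rfl, rfl⟩)) search_four_tight
    obtain ⟨h1, h2⟩ := lift (by omega) h
    exact C.not_low (j := 10) (by omega) (by omega) h1 h2
  · refine search_ne_true (ρ := 10) (C.branch (by omega) hx hy) (by omega) (by omega) rfl
      (C.goodImage (strong := true) (by omega) (by simp) fun h => ?_) himg
      (htight (C.one_ne_merged (ρ := 10) (by omega) (by omega) (by omega) hx hy))
      (C.goodTables (.inr ⟨le_rfl, rfl⟩)) search_five_ties
    obtain ⟨h1, h2⟩ := lift (by omega) h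
    exact C.not_low (j := 9) (by omega) (by omega) h1 h2
  · by_cases hlow : R 10 {p, q, x} ∧ R 10 {p, q, y}
    · refine search_ne_true (ρ := 10) (C.branch (by omega) hlow.1 hlow.2) (by omega) (by omega) rfl
        (C.goodImage (strong := false) (by omega) (by simp) fun h => ?_) himg
        (htight (C.one_ne_merged (ρ := 10) (by omega) (by omega) (by omega) hlow.1 hlow.2))
        (C.goodTables (.inr ⟨le_rfl, rfl⟩)) search_five_tight
      obtain ⟨h1, h2⟩ := lift (by omega) h
      exact C.not_low_of_eq (by omega) (by omega) h1 h2 (by omega)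
    · exact search_ne_true (ρ := 11) (C.branch (by omega) hx hy) (by omega) (by omega) rfl
        (C.goodImage (strong := false) (by omega) (by simp) fun h => hlow (lift (by omega) h)) himg
        hall (C.goodTables (.inr ⟨le_rfl, rfl⟩)) search_five_loose

end QuadChain

end SetSearch

namespace Layering

variable {R : ℕ → Finset (Fin 5) → Prop} (hR : Layering R)
include hR

theorem level_le_of_card_le_three {r : ℕ} {X : Finset (Fin 5)} (h : AtLevel R r X)
    (hX : X.card ≤ 3) : r ≤ 20 := by
  refine (hR.level_le_sum h).trans ?_
  have := (hR.nonempty h.1).card_pos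
  interval_cases X.card <;> decide

/-- A chain of quads on consecutive levels above a triple, in normal position. -/
theorem no_quad_chain {L : ℕ} (h18 : 18 ≤ L) (h19 : L ≤ 19) {T : Finset (Fin 5)} (hT : AtLevel R L T)
    (hTc : T.card ≤ 3) (hstep : Transfers R (Finset.univ.erase 0) T)
    (hback : ∀ i j : Fin 5, j.val = i.val + 1 → L + 1 + j.val ≤ 23 →
      Transfers R (Finset.univ.erase j) (Finset.univ.erase i))
    (hsync : ∀ i : Fin 5, i.val < 4 → R 23 (Finset.univ.erase i)) : False := by
  classical
  obtain ⟨f, rfl, hm⟩ := hstep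
  have hpairs : ∀ Z : Finset (Fin 5), Z.card = 2 → R 10 Z := by
    -- A pair omits three states, at least two of them less than 4, so it is inside a quad that is
    -- known to synchronize.
    have key : ∀ Z : Finset (Fin 5), Z.card = 2 → ∃ i : Fin 5, i.val < 4 ∧ Z ⊆ Finset.univ.erase i := by
      decide +kernel
    intro Z hZ
    obtain ⟨i, hi, hZi⟩ := key Z hZ
    exact hR.pair_within_ten (hR.subset (hsync i hi) hZi (Finset.card_pos.mp (by omega))) (by omega)
  have hcard : ((Finset.univ.erase 0).image f).card = 3 := by
    have h2 := hR.two_le_card hT (by omega)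
    by_contra hne
    have := hR.atLevel_le hT (hpairs _ (by omega))
    omega
  obtain ⟨p₀, hp₀, q₀, hq₀, hpq₀, hf₀⟩ := Finset.exists_ne_map_eq_of_card_lt_of_maps_to
    (s := (Finset.univ : Finset (Fin 5)).erase 0) (t := (Finset.univ.erase 0).image f)
    (by rw [hcard]; decide) (fun a ha => Finset.mem_image_of_mem f ha)
  obtain ⟨⟨p, q, x, y⟩, hv, hord⟩ := SetSearch.exists_merge_order p₀ q₀
    (Finset.ne_of_mem_erase hp₀) (Finset.ne_of_mem_erase hq₀) hpq₀
  have hall := SetSearch.mem_allSources _ hv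
  have hne := SetSearch.merge_order_ne _ hv
  have hquad := SetSearch.merge_order_eq _ hv
  have htight := SetSearch.merge_order_tight _ hv
  simp only at hord hne hquad hall
  have hf : f p = f q := by
    rcases hord with ⟨rfl, rfl⟩ | ⟨rfl, rfl⟩
    exacts [hf₀, hf₀.symm]
  have himg : (Finset.univ.erase 0).image f = {f p, f x, f y} := by
    rw [← hquad]
    simp [Finset.image_insert, hf]
  rw [himg] at hT hcard
  have himg_ne : f p ≠ f x ∧ f p ≠ f y ∧ f x ≠ f y := by
    refine ⟨fun h => ?_, fun h => ?_, fun h => ?_⟩ <;> rw [h] at hcard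
    · have := Finset.card_le_two (a := f x) (b := f y)
      simp only [Finset.mem_insert_self, Finset.insert_eq_of_mem] at hcard
      omega
    · have := Finset.card_le_two (a := f x) (b := f y)
      rw [Finset.insert_comm, Finset.pair_eq_singleton] at hcard
      omega
    · have := Finset.card_le_two (a := f p) (b := f y)
      rw [Finset.pair_eq_singleton] at hcard
      omega
  have hex : ∃ c, ∀ Z : Finset (Fin 5), Z.card = 2 → R c Z := ⟨10, hpairs⟩
  -- With `c` minimal, some pair is on level `c` (if c > 0), and descending from it yields a pair on
  -- each positive level up to `c`.
  obtain ⟨c, hc⟩ : ∃ c, c = Nat.find hex := ⟨_, rfl⟩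
  refine SetSearch.QuadChain.elim (R := R) (c := c) (L := L) (f := f) (p := p) (q := q) (x := x)
    (y := y) ⟨hR, hm, hf, hquad, hne, himg_ne, hT, hback, ?_, fun j hj => ?_, ?_⟩ h18 hall
    fun h => SetSearch.mem_tightSources _ (htight h)
  · rw [hc]; exact Nat.find_spec hex
  · have hmin := Nat.find_min hex (m := c - 1) (by omega)
    push Not at hmin
    obtain ⟨Z, hZ, hRZ⟩ := hmin
    have hcZ : R c Z := by rw [hc]; exact Nat.find_spec hex Z hZ
    obtain ⟨c, rfl⟩ : ∃ c', c = c' + 1 := ⟨c - 1, by omega⟩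
    obtain ⟨Y, hY, hYc⟩ := hR.exists_atLevel_of_le (hR.atLevel_of_not hcZ hRZ)
      (show j + 1 ≤ c + 1 by omega)
    have := hR.two_le_card hY (by omega)
    exact ⟨Y, by omega, hY.1, hY.2 j (by omega)⟩
  · rw [hc]; exact Nat.find_min' hex hpairs

/-- The quads from L + 1 to 23 are distinct, so L ≥ 18. The two low triples are within 11, so only
eight triples remain for levels 12 to `L`, and L ≤ 19. -/
theorem level_le_of_quad {r : ℕ} {X : Finset (Fin 5)} (h : AtLevel R r X) (hX : X.card = 4) :
    r ≤ 22 := by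
  by_contra! hr
  obtain ⟨Y, hY, hYc⟩ := hR.exists_atLevel_of_le h (show 23 ≤ r by omega)
  have hY4 : Y.card = 4 := by
    by_contra hne
    have := hR.level_le_of_card_le_three hY (by omega)
    omega
  obtain ⟨L, hL, s, T, hT, hTc, hstep, hs, hback⟩ := hR.exists_quad_chain hY hY4
  choose! m hm using fun i (hi : L < i ∧ i ≤ 23) => eq_erase_of_card_four (hs i hi.1 hi.2).2
  have hinj : ∀ i, L < i → i ≤ 23 → ∀ j, L < j → j ≤ 23 → m i = m j → i = j := by
    intro i hi hi' j hj hj' hij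
    have h1 := (hs i hi hi').1
    have h2 := (hs j hj hj').1
    rw [hm i ⟨hi, hi'⟩, hij, ← hm j ⟨hj, hj'⟩] at h1
    exact hR.atLevel_unique h1 h2
  have h18 : 18 ≤ L := by
    have : (Finset.Ioc L 23).card ≤ (Finset.univ : Finset (Fin 5)).card := by
      refine Finset.card_le_card_of_injOn m (by simp) ?_
      intro i hi j hj hij
      simp only [Finset.coe_Ioc, Set.mem_Ioc] at hi hj
      exact hinj i hi.1 hi.2 j hj.1 hj.2 hij
    simp at this
    omega
  have h19 : L ≤ 19 := by
    obtain ⟨U, V, hUV, hU, hV, hRU, hRV⟩ := hR.exists_low_triples h.1 hX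
    norm_num [Nat.choose] at hRU hRV
    have := hR.sub_le_card (i := 11) hT (((Finset.powersetCard 3 Finset.univ).erase U).erase V) (by
      intro Z j hj _ hZ hZc
      have h2 := hR.two_le_card hZ (by omega)
      have h3 : Z.card = 3 := by
        by_contra hne
        have := hR.atLevel_le hZ (hR.pair_within_ten hZ.1 (by omega))
        omega
      refine Finset.mem_erase.mpr ⟨?_, Finset.mem_erase.mpr ⟨?_, by simpa using h3⟩⟩
      · rintro rfl
        have := hR.atLevel_le hZ hRV
        omega
      · rintro rfl
        have := hR.atLevel_le hZ hRU
        omega)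
    rw [Finset.card_erase_of_mem (by simp [hV, Ne.symm hUV]), Finset.card_erase_of_mem (by simp [hU]),
      Finset.card_powersetCard] at this
    norm_num [Nat.choose] at this
    omega
  -- State i is to name the state omitted by the quad on level L + 1 + i. For L = 19 this determines
  -- only four states, so the partial injection is extended to a permutation.
  obtain ⟨e, he⟩ : ∃ e : Fin 5 ≃ Fin 5, ∀ i : Fin 5, L + 1 + i.val ≤ 23 → e i = m (L + 1 + i.val) := by
    obtain ⟨g, hg⟩ := Finset.exists_equiv_extend_of_card_eq (t := (Finset.univ : Finset (Fin 5)))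
      (by simp) (s := Finset.univ.filter fun i : Fin 5 => L + 1 + i.val ≤ 23)
      (f := fun i => m (L + 1 + i.val)) (by simp) (by
        intro i hi j hj hij
        simp only [Finset.coe_filter, Finset.mem_univ, true_and, Set.mem_ofPred_eq] at hi hj
        have := hinj _ (by omega) hi _ (by omega) hj hij
        exact Fin.ext (by omega))
    exact ⟨g.trans (Equiv.subtypeUnivEquiv fun i => Finset.mem_univ i), fun i hi =>
      hg i (by simpa using hi)⟩
  have hmap : ∀ i : Fin 5, L + 1 + i.val ≤ 23 →
      (Finset.univ.erase i).map e.toEmbedding = s (L + 1 + i.val) := by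
    intro i hi
    rw [hm _ ⟨by omega, hi⟩, Finset.map_erase, Finset.map_univ_equiv, ← he i hi]
    rfl
  have hTe : (T.map e.symm.toEmbedding).map e.toEmbedding = T := by
    ext i; simp
  refine (hR.map_equiv e).no_quad_chain h18 h19 (T := T.map e.symm.toEmbedding) ?_ (by simpa using hTc) ?_ ?_ ?_
  · unfold AtLevel
    simp only [hTe]
    exact hT
  · refine Transfers.map_equiv e ?_
    rw [hTe, hmap 0 (by simp; omega)]
    exact hstep
  · intro i j hij hj
    refine Transfers.map_equiv e ?_
    rw [hmap i (by omega), hmap j hj, hij]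
    exact hback (L + 1 + i.val) (by omega) (by omega)
  · intro i hi
    simp only [hmap i (by omega)]
    have hsi : L + 1 + i.val ≤ 23 := by omega
    exact hR.mono hsi (hs _ (by omega) hsi).1.1

end Layering

/-! ### Automata that attain the table entries -/

namespace PartialAutomaton

/-- The partial automaton whose letters are the rows of a table; an entry that is not less than `n`
stands for an undefined transition. -/
def ofTable {n m : ℕ} (t : Fin m → Fin n → ℕ) : PartialAutomaton (Fin n) (Fin m) where
  step q a := if h : t a q < n then some ⟨t a q, h⟩ else none

/-- A function on sets that decreases by at most one with every letter is a lower bound for the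
synchronization length. -/
theorem le_length_of_potential {Q A : Type*} [DecidableEq Q] (M : PartialAutomaton Q A)
    (φ : Finset Q → ℕ) (h0 : ∀ T : Finset Q, T.card = 1 → φ T = 0)
    (h1 : ∀ (T : Finset Q) (a : A), M.stepSet T a = ∅ ∨ φ T ≤ φ (M.stepSet T a) + 1)
    (S : Finset Q) (w : List A) (hw : (M.runSet S w).card = 1) : φ S ≤ w.length := by
  induction w generalizing S with
  | nil => exact (h0 S hw).le
  | cons a w ih =>
    rcases h1 S a with h | h
    · rw [runSet, h, runSet_empty] at hw
      simp at hw
    · exact h.trans (Nat.succ_le_succ (ih _ hw))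

theorem syncLength_eq_of_potential {Q A : Type*} [DecidableEq Q] (M : PartialAutomaton Q A)
    (φ : Finset Q → ℕ) (h0 : ∀ T : Finset Q, T.card = 1 → φ T = 0)
    (h1 : ∀ (T : Finset Q) (a : A), M.stepSet T a = ∅ ∨ φ T ≤ φ (M.stepSet T a) + 1)
    {S : Finset Q} {w : List A} (hw : (M.runSet S w).card = 1) (hφ : w.length = φ S) :
    M.Synchronizes S ∧ M.syncLength S = φ S := by
  have hin : M.SynchronizesIn S (φ S) := ⟨w, hφ, hw⟩
  refine ⟨⟨_, hin⟩, le_antisymm (Nat.sInf_le hin) (le_csInf ⟨_, hin⟩ ?_)⟩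
  rintro l ⟨v, rfl, hv⟩
  exact M.le_length_of_potential φ h0 h1 S v hv

/-- The function on sets with the given values on the codes `∑ i ∈ T, 2 ^ i`. -/
def potential {n : ℕ} (l : List ℕ) (T : Finset (Fin n)) : ℕ := l.getD (∑ i ∈ T, 2 ^ i.val) 0

theorem exists_syncLength_3_2 : ∃ (m : ℕ) (M : PartialAutomaton (Fin 3) (Fin m)) (S : Finset (Fin 3)),
    S.card = 2 ∧ M.Synchronizes S ∧ M.syncLength S = 3 := by
  refine ⟨3, ofTable ![![2, 0, 3], ![2, 3, 1], ![3, 0, 0]], {0, 1}, by decide, ?_⟩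
  exact syncLength_eq_of_potential _ (potential [0, 0, 0, 3, 0, 2, 1, 3])
    (by decide +kernel) (by decide +kernel)
    (w := [0, 1, 2]) (by decide +kernel) (by decide +kernel)

theorem exists_syncLength_3_3 : ∃ (m : ℕ) (M : PartialAutomaton (Fin 3) (Fin m)) (S : Finset (Fin 3)),
    S.card = 3 ∧ M.Synchronizes S ∧ M.syncLength S = 4 := by
  refine ⟨3, ofTable ![![1, 0, 0], ![2, 0, 3], ![2, 3, 1]], {0, 1, 2}, by decide, ?_⟩
  exact syncLength_eq_of_potential _ (potential [0, 0, 0, 3, 0, 2, 1, 4])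
    (by decide +kernel) (by decide +kernel)
    (w := [0, 1, 2, 0]) (by decide +kernel) (by decide +kernel)

theorem exists_syncLength_4_2 : ∃ (m : ℕ) (M : PartialAutomaton (Fin 4) (Fin m)) (S : Finset (Fin 4)),
    S.card = 2 ∧ M.Synchronizes S ∧ M.syncLength S = 6 := by
  refine ⟨6, ofTable ![![4, 4, 3, 1], ![4, 1, 4, 0], ![0, 3, 4, 4], ![2, 4, 4, 0], ![1, 4, 2, 4],
      ![4, 0, 0, 4]], {2, 3}, by decide, ?_⟩
  exact syncLength_eq_of_potential _ (potential [0, 0, 0, 4, 0, 2, 1, 6, 0, 3, 5, 6, 6, 6, 6, 6])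
    (by decide +kernel) (by decide +kernel)
    (w := [0, 1, 2, 3, 4, 5]) (by decide +kernel) (by decide +kernel)

theorem exists_syncLength_4_3 : ∃ (m : ℕ) (M : PartialAutomaton (Fin 4) (Fin m)) (S : Finset (Fin 4)),
    S.card = 3 ∧ M.Synchronizes S ∧ M.syncLength S = 10 := by
  refine ⟨4, ofTable ![![4, 3, 0, 1], ![0, 3, 4, 2], ![2, 4, 1, 0], ![1, 3, 3, 4]], {1, 2, 3}, by
      decide, ?_⟩
  exact syncLength_eq_of_potential _ (potential [0, 0, 0, 4, 0, 2, 1, 7, 0, 3, 6, 9, 5, 8, 10,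
      10])
    (by decide +kernel) (by decide +kernel)
    (w := [0, 1, 2, 3, 1, 0, 1, 1, 2, 3]) (by decide +kernel) (by decide +kernel)

theorem exists_syncLength_4_4 : ∃ (m : ℕ) (M : PartialAutomaton (Fin 4) (Fin m)) (S : Finset (Fin 4)),
    S.card = 4 ∧ M.Synchronizes S ∧ M.syncLength S = 10 := by
  refine ⟨4, ofTable ![![0, 1, 1, 3], ![0, 3, 4, 2], ![1, 4, 2, 3], ![4, 4, 1, 0]], {0, 1, 2, 3},
      by decide, ?_⟩
  exact syncLength_eq_of_potential _ (potential [0, 0, 0, 4, 0, 2, 1, 5, 0, 3, 6, 9, 5, 8, 7, 10])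
    (by decide +kernel) (by decide +kernel)
    (w := [0, 1, 2, 0, 1, 3, 1, 1, 2, 0]) (by decide +kernel) (by decide +kernel)

theorem exists_syncLength_5_2 : ∃ (m : ℕ) (M : PartialAutomaton (Fin 5) (Fin m)) (S : Finset (Fin 5)),
    S.card = 2 ∧ M.Synchronizes S ∧ M.syncLength S = 10 := by
  refine ⟨10, ofTable ![![5, 0, 5, 5, 3], ![4, 5, 5, 3, 5], ![5, 5, 5, 2, 0], ![0, 5, 4, 5, 5],
      ![0, 5, 5, 5, 1], ![2, 3, 5, 5, 5], ![5, 5, 3, 1, 5], ![5, 4, 5, 2, 5], ![5, 5, 1, 5, 2],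
      ![5, 0, 0, 5, 5]], {1, 4}, by decide, ?_⟩
  exact syncLength_eq_of_potential _ (potential [0, 0, 0, 5, 0, 7, 1, 10, 0, 9, 3, 10, 4, 10, 10,
      10, 0, 6, 10, 10, 2, 10, 10, 10, 8, 10, 10, 10, 10, 10, 10, 10])
    (by decide +kernel) (by decide +kernel)
    (w := [0, 1, 2, 3, 4, 5, 6, 7, 8, 9]) (by decide +kernel) (by decide +kernel)

/-- The potential takes the values 1 to 10 on the pairs and 11 to 20 on the triples, so the counting
bound is met with one set on each level. -/
theorem exists_syncLength_5_3 : ∃ (m : ℕ) (M : PartialAutomaton (Fin 5) (Fin m)) (S : Finset (Fin 5)),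
    S.card = 3 ∧ M.Synchronizes S ∧ M.syncLength S = 20 := by
  refine ⟨10, ofTable ![![4, 1, 2, 5, 5], ![5, 4, 2, 5, 0], ![4, 5, 3, 5, 1], ![5, 4, 5, 1, 0],
      ![3, 4, 5, 5, 0], ![3, 5, 5, 1, 0], ![1, 2, 5, 3, 5], ![5, 2, 4, 3, 5], ![5, 5, 2, 3, 0],
      ![1, 5, 1, 4, 5]], {0, 1, 2}, by decide, ?_⟩
  exact syncLength_eq_of_potential _ (potential [0, 0, 0, 4, 0, 1, 3, 20, 0, 8, 7, 14, 6, 11, 13,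
      20, 0, 9, 10, 16, 2, 18, 19, 20, 5, 15, 17, 20, 12, 20, 20, 20])
    (by decide +kernel) (by decide +kernel)
    (w := [0, 1, 2, 3, 4, 5, 6, 7, 8, 9, 1, 4, 5, 6, 7, 3, 6, 1, 1, 9]) (by decide +kernel) (by
      decide +kernel)

/-- Four quads have the values 19 to 22. Every letter is undefined somewhere on the fifth quad
{1,2,3,4}, so that quad does not synchronize and its value 22 only has to be large enough. -/
theorem exists_syncLength_5_4 : ∃ (m : ℕ) (M : PartialAutomaton (Fin 5) (Fin m)) (S : Finset (Fin 5)),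
    S.card = 4 ∧ M.Synchronizes S ∧ M.syncLength S = 22 := by
  refine ⟨6, ofTable ![![0, 2, 5, 4, 3], ![0, 5, 4, 1, 2], ![0, 1, 2, 5, 3], ![0, 2, 2, 4, 5],
      ![3, 1, 5, 4, 5], ![5, 0, 5, 1, 5]], {0, 1, 3, 4}, by decide, ?_⟩
  exact syncLength_eq_of_potential _ (potential [0, 0, 0, 6, 0, 5, 1, 6, 0, 3, 7, 15, 9, 17, 11,
      19, 0, 4, 8, 16, 10, 18, 12, 20, 2, 7, 14, 22, 13, 21, 22, 22])
    (by decide +kernel) (by decide +kernel)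
    (w := [0, 1, 2, 3, 2, 1, 2, 4, 0, 1, 2, 3, 2, 1, 2, 5, 0, 1, 0, 4, 1, 3]) (by decide +kernel)
      (by decide +kernel)

theorem exists_syncLength_5_5 : ∃ (m : ℕ) (M : PartialAutomaton (Fin 5) (Fin m)) (S : Finset (Fin 5)),
    S.card = 5 ∧ M.Synchronizes S ∧ M.syncLength S = 21 := by
  refine ⟨6, ofTable ![![5, 0, 2, 3, 4], ![4, 5, 2, 0, 1], ![3, 5, 2, 5, 1], ![1, 5, 4, 3, 5],
      ![1, 1, 2, 3, 4], ![2, 5, 5, 4, 5]], {0, 1, 2, 3, 4}, by decide, ?_⟩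
  exact syncLength_eq_of_potential _ (potential [0, 0, 0, 1, 0, 4, 5, 6, 0, 7, 8, 9, 3, 14, 15,
      16, 0, 9, 10, 11, 6, 16, 17, 18, 2, 12, 13, 14, 7, 19, 20, 21])
    (by decide +kernel) (by decide +kernel)
    (w := [4, 0, 1, 4, 0, 2, 0, 3, 0, 1, 4, 0, 2, 0, 5, 1, 0, 2, 3, 1, 4]) (by decide +kernel) (by
      decide +kernel)

end PartialAutomaton

/-! ### Assembling the two parts -/

namespace PartialAutomaton

variable {Q : Type*} {A : Type*} [DecidableEq Q] (M : PartialAutomaton Q A)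

theorem synchronizes_iff {T : Finset Q} : M.Synchronizes T ↔ ∃ j, M.SyncWithin j T :=
  ⟨fun ⟨l, h⟩ => ⟨l, l, le_rfl, h⟩, fun ⟨_, l, _, h⟩ => ⟨l, h⟩⟩

omit [DecidableEq Q] in
theorem atLevel_map_equiv {P : Type*} [DecidableEq P] (e : P ≃ Q) {R : ℕ → Finset Q → Prop} {r : ℕ}
    {S : Finset Q} (h : AtLevel R r S) :
    AtLevel (fun j (X : Finset P) => R j (X.map e.toEmbedding)) r (S.map e.symm.toEmbedding) := by
  have hS : (S.map e.symm.toEmbedding).map e.toEmbedding = S := by ext; simp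
  simpa only [AtLevel, hS] using h

variable [Fintype Q]

/-- If a smaller set does not synchronize, the table entry is not attained. -/
theorem syncLength_lt_of_not_synchronizes (hQ : Fintype.card Q ≤ 5) {S T : Finset Q}
    (hS : M.Synchronizes S) (hT : T.Nonempty) (hTS : T.card < S.card) (hn : ¬ M.Synchronizes T) :
    M.syncLength S < pfaTable (Fintype.card Q) S.card := by
  have hR := M.layering_syncWithin
  have hlev := M.atLevel_syncLength hS
  rw [synchronizes_iff, not_exists] at hn
  have hT2 : 2 ≤ T.card := by
    have h0 := hT.card_pos
    have h1 : T.card ≠ 1 := fun h => hn 0 (hR.of_card_eq_one h 0)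
    omega
  -- The full set cannot occur: if it synchronized, then so would its subset `T`.
  have hSQ : S.card < Fintype.card Q := by
    refine lt_of_le_of_ne (Finset.card_le_univ S) fun h => ?_
    rw [Finset.card_eq_iff_eq_univ] at h
    exact hn _ (hR.subset hlev.1 (h ▸ Finset.subset_univ T) hT)
  rcases (show S.card = 3 ∨ S.card = 4 by omega) with h3 | h4
  · have := hR.level_lt_sum hlev hn hT2 hTS.le
    rcases (show Fintype.card Q = 4 ∨ Fintype.card Q = 5 by omega) with hq | hq <;>
      rw [h3, hq] at this ⊢ <;> exact this
  · have hq : Fintype.card Q = 5 := by omega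
    have e : Fin 5 ≃ Q := (Fintype.equivFinOfCardEq hq).symm
    rw [h4, hq]
    refine (hR.map_equiv e).level_lt_of_not_sync (atLevel_map_equiv e hlev) (by simpa using h4)
      (T := T.map e.symm.toEmbedding) (fun j hj => hn j ?_) (by simpa using hT) (by simp; omega)
    have hTe : (T.map e.symm.toEmbedding).map e.toEmbedding = T := by ext; simp
    rwa [hTe] at hj

theorem syncLength_le_table (h3 : 3 ≤ Fintype.card Q) (h5 : Fintype.card Q ≤ 5) {S : Finset Q}
    (hS : M.Synchronizes S) (h2 : 2 ≤ S.card) :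
    M.syncLength S ≤ pfaTable (Fintype.card Q) S.card := by
  have hR := M.layering_syncWithin
  have hlev := M.atLevel_syncLength hS
  have hsum := hR.level_le_sum hlev
  have hSQ := Finset.card_le_univ S
  -- For |S| ≤ 3 the table entry evaluates to the binomial sum itself.
  rcases (show S.card = 2 ∨ S.card = 3 ∨ S.card = 4 ∨ S.card = 5 by omega) with hs | hs | hs | hs
  · rcases (show Fintype.card Q = 3 ∨ Fintype.card Q = 4 ∨ Fintype.card Q = 5 by omega) with
      hq | hq | hq <;> rw [hs, hq] at hsum ⊢ <;> exact hsum
  · rcases (show Fintype.card Q = 3 ∨ Fintype.card Q = 4 ∨ Fintype.card Q = 5 by omega) with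
      hq | hq | hq <;> rw [hs, hq] at hsum ⊢ <;> exact hsum
  · rcases (show Fintype.card Q = 4 ∨ Fintype.card Q = 5 by omega) with hq | hq
    · rw [hs, hq]
      exact hR.level_le_of_card_four hq hlev hs
    · rw [hs, hq]
      have e : Fin 5 ≃ Q := (Fintype.equivFinOfCardEq hq).symm
      exact (hR.map_equiv e).level_le_of_quad (atLevel_map_equiv e hlev) (by simpa using hs)
  · have hq : Fintype.card Q = 5 := by omega
    rw [hs, hq]
    have e : Fin 5 ≃ Q := (Fintype.equivFinOfCardEq hq).symm
    refine (hR.map_equiv e).level_univ_le (r := M.syncLength S) ?_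
    have := atLevel_map_equiv e hlev
    rwa [(Finset.card_eq_iff_eq_univ (S.map e.symm.toEmbedding)).mp (by simpa using hs)] at this

theorem exists_syncLength_eq_table : ∀ n k : ℕ, 3 ≤ n → n ≤ 5 → 2 ≤ k → k ≤ n →
    ∃ (m : ℕ) (M : PartialAutomaton (Fin n) (Fin m)) (S : Finset (Fin n)),
      S.card = k ∧ M.Synchronizes S ∧ M.syncLength S = pfaTable n k := by
  intro n k hn hn' hk hk'
  interval_cases n <;> interval_cases k
  exacts [exists_syncLength_3_2, exists_syncLength_3_3, exists_syncLength_4_2,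
    exists_syncLength_4_3, exists_syncLength_4_4, exists_syncLength_5_2, exists_syncLength_5_3,
    exists_syncLength_5_4, exists_syncLength_5_5]

end PartialAutomaton

/-- First part: if `S` synchronizes, but some smaller nonempty set of states does not, then the
synchronization length of `S` is less than the table entry. (Such an `S` has at least `3` elements,
because singletons synchronize, so the entry exists.)
Second part: every table entry is the maximum synchronization length: it is an upper bound for all
PFAs over arbitrary alphabets, and it is attained by a PFA with a finite alphabet. -/
theorem mainTheorem11 :
    (∀ (Q : Type u) [Fintype Q] [DecidableEq Q] (A : Type v) (M : PartialAutomaton Q A)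
        (S : Finset Q),
      Fintype.card Q ≤ 5 → M.Synchronizes S →
      (¬ ∀ T : Finset Q, T.Nonempty → T.card < S.card → M.Synchronizes T) →
      M.syncLength S < pfaTable (Fintype.card Q) S.card) ∧
    (∀ n k : ℕ, 3 ≤ n → n ≤ 5 → 2 ≤ k → k ≤ n →
      (∀ (Q : Type u) [Fintype Q] [DecidableEq Q] (A : Type v) (M : PartialAutomaton Q A)
          (S : Finset Q),
        Fintype.card Q = n → S.card = k → M.Synchronizes S → M.syncLength S ≤ pfaTable n k) ∧
      (∃ (m : ℕ) (M : PartialAutomaton (Fin n) (Fin m)) (S : Finset (Fin n)),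
        S.card = k ∧ M.Synchronizes S ∧ M.syncLength S = pfaTable n k)) := by
  refine ⟨fun Q _ _ A M S hQ hS h => ?_, fun n k hn hn' hk hk' => ⟨fun Q _ _ A M S hQ hS h => ?_,
    PartialAutomaton.exists_syncLength_eq_table n k hn hn' hk hk'⟩⟩
  · push Not at h
    obtain ⟨T, hT, hTS, hn⟩ := h
    exact M.syncLength_lt_of_not_synchronizes hQ hS hT hTS hn
  · subst hQ hS
    exact M.syncLength_le_table hn hn' h hk
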